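/- **Theorem (reproducing formula on Minkowski space).** Let $\mathbb H_{\mathbb C}$ be the algebra of complex $2\times2$ matrices $Z=(z_{ij})$, let $N(Z)=\det Z$, and let $Z^*$ be the conjugate transpose of $Z$. Put $$\mathbb M=\{Z\in\mathbb H_{\mathbb C}: Z^*=-Z\},\qquad C^+=\{Y\in\mathbb M: N(Y)<0,\ i\operatorname{Tr}Y<0\},\qquad \mathbb T^\pm=\mathbb M\pm iC^+,$$ $$\mathbb D^+=\{Z: ZZ^*<1\},\qquad \mathbb D^-=\{Z: ZZ^*>1\}.$$ For $h=\begin{pmatrix}a'&b'\\c'&d'\end{pmatrix}\in GL(2,\mathbb H_{\mathbb C})$ with $h^{-1}=\begin{pmatrix}a&b\\c&d\end{pmatrix}$ let $$(\rho_1(h)F)(Z)=\frac{F\bigl((aZ+b)(cZ+d)^{-1}\bigr)}{N(cZ+d)\,N(a'-Zc')},\qquad\text{and let}\quad \gamma=\begin{pmatrix}i&1\\i&-1\end{pmatrix}.$$ Let $\mathrm{Zh}(\mathbb M)^+$ be the space of holomorphic functions $F$ on $\mathbb T^+$ such that $\rho_1(\gamma^{-1})F$, which is defined on $\mathbb D^+$,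 extends to a holomorphic function on a neighborhood of the closure of $\mathbb D^+$. Let $\mathrm{Zh}(\mathbb M)^-$ be the space of holomorphic functions $F$ on $\mathbb T^-$ such that $\rho_1(\gamma^{-1})F$, which is defined on $\mathbb D^-$, extends to a holomorphic function $G$ on a neighborhood of the closure of $\mathbb D^-$ that is regular at infinity, i.e. $\bigl(\rho_1\begin{pmatrix}0&1\\1&0\end{pmatrix}G\bigr)(Z)=N(Z)^{-2}\,G(Z^{-1})$, defined for invertible $Z$ near $0$, extends holomorphically to a neighborhood of $0$. The values of $F\in\mathrm{Zh}(\mathbb M)^\pm$ on $\mathbb M$ are its boundary values, i.e. its limits from within $\mathbb T^\pm$. Let $dZ^4=dz_{11}\wedge dz_{12}\wedge dz_{21}\wedge dz_{22}$, and orient $\mathbb M$ by its basis $$\tilde e_0=\begin{pmatrix}-i&0\\0&-i\end{pmatrix},\quad e_1=\begin{pmatrix}0&-i\\-i&0\end{pmatrix},\quad e_2=\begin{pmatrix}0&-1\\1&0\end{pmatrix},\quad e_3=\begin{pmatrix}-i&0\\0&i\end{pmatrix}.$$ Write $\langle F_1,F_2\rangle_1=\frac{i}{8\pi^3}\int_{\mathbb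 M}F_1(Z)F_2(Z)\,dZ^4$. Then for all $F\in\mathrm{Zh}(\mathbb M)^+$ and all $W\in\mathbb T^+$ the boundary values of $F$ exist at every point of $\mathbb M$, the integral below converges absolutely, and $$F(W)=\Bigl\langle F(Z),\frac1{N(Z-W)^2}\Bigr\rangle_1=\frac{i}{8\pi^3}\int_{Z\in\mathbb M}\frac{F(Z)}{N(Z-W)^2}\,dZ^4 .$$ Similarly, for all $F\in\mathrm{Zh}(\mathbb M)^-$ and all $W\in\mathbb T^-$ the boundary values of $F$ exist at every point of $\mathbb M$, the integral converges absolutely, and the same formula holds. -/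

import Mathlib

open scoped Matrix ComplexOrder

noncomputable section

/-- The algebra `ℍ_ℂ` of complexified quaternions, realized as the complex `2 × 2` matrices, with
its usual topology. -/
abbrev HC : Type := Matrix (Fin 2) (Fin 2) ℂ

namespace HC

open Complex Topology MeasureTheory Filter

/-- The quadratic norm `N(Z) = z₁₁ z₂₂ - z₁₂ z₂₁`. -/
def N (Z : HC) : ℂ := Z.det

/-! ### Minkowski space, tube domains, bounded domains -/

/-- Minkowski space `𝕄 = {Z ; Z* = -Z}`. -/
def minkowski : Set HC := {Z | Zᴴ = -Z}

/-- The open cone `C⁺ = {Y ∈ 𝕄 ; N(Y) < 0, i Tr Y < 0}`; both numbers are real for `Y ∈ 𝕄`. -/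
def cone : Set HC := {Y | Y ∈ minkowski ∧ (N Y).re < 0 ∧ (I * Y.trace).re < 0}

/-- The tube domain `𝕋⁺ = 𝕄 + i C⁺`. -/
def tubePlus : Set HC := {Z | ∃ X ∈ minkowski, ∃ Y ∈ cone, Z = X + I • Y}

/-- The tube domain `𝕋⁻ = 𝕄 - i C⁺`. -/
def tubeMinus : Set HC := {Z | ∃ X ∈ minkowski, ∃ Y ∈ cone, Z = X - I • Y}

/-- The bounded domain `𝔻⁺ = {Z ; Z Z* < 1}`. -/
def discPlus : Set HC := {Z | (1 - Z * Zᴴ).PosDef}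

/-- The domain `𝔻⁻ = {Z ; Z Z* > 1}`. -/
def discMinus : Set HC := {Z | (Z * Zᴴ - 1).PosDef}

/-! ### The action `ρ₁` -/

/-- `GL(2, ℍ_ℂ)`: the invertible `2 × 2` matrices with entries in `ℍ_ℂ`. -/
abbrev GL2 : Type := (Matrix (Fin 2) (Fin 2) HC)ˣ

/-- The action `ρ₁(h) : F(Z) ↦ F((aZ+b)(cZ+d)⁻¹) / (N(cZ+d) N(a'-Zc'))`, where
`h = (a' b'; c' d')` and `h⁻¹ = (a b; c d)`. -/
def rho1 (h : GL2) (F : HC → ℂ) (Z : HC) : ℂ :=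
  let a : HC := (h⁻¹).val 0 0
  let b : HC := (h⁻¹).val 0 1
  let c : HC := (h⁻¹).val 1 0
  let d : HC := (h⁻¹).val 1 1
  let a' : HC := h.val 0 0
  let c' : HC := h.val 1 0
  F ((a * Z + b) * (c * Z + d)⁻¹) / (N (c * Z + d) * N (a' - Z * c'))

/-- The element `γ = (i 1; i -1)` of `GL(2, ℍ_ℂ)`, which gives the Cayley transform. -/
def cayley : GL2 where
  val := !![I • (1 : HC), 1; I • (1 : HC), -1]
  inv := !![(-I / 2) • (1 : HC), (-I / 2) • (1 : HC);
            (1 / 2 : ℂ) • (1 : HC), (-1 / 2 : ℂ) • (1 : HC)]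
  val_inv := by
    ext i j k l
    fin_cases i <;> fin_cases j <;> fin_cases k <;> fin_cases l <;>
      simp [Matrix.mul_apply, Fin.sum_univ_two] <;> ring_nf <;> simp
    all_goals norm_num
  inv_val := by
    ext i j k l
    fin_cases i <;> fin_cases j <;> fin_cases k <;> fin_cases l <;>
      simp [Matrix.mul_apply, Fin.sum_univ_two] <;> ring_nf <;> simp

/-- The element `(0 1; 1 0)` of `GL(2, ℍ_ℂ)`, which acts by the inversion `Z ↦ Z⁻¹`. -/
def inversion : GL2 where
  val := !![0, 1; 1, 0]
  inv := !![0, 1; 1, 0]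
  val_inv := by simp [Matrix.one_fin_two]
  inv_val := by simp [Matrix.one_fin_two]

theorem rho1_inversion (F : HC → ℂ) (Z : HC) : rho1 inversion F Z = F Z⁻¹ / N Z ^ 2 := by
  have h : (-Z).det = Z.det := by simp [Matrix.det_neg]
  simp [rho1, inversion, N, h, sq]

theorem rho1_cayley_inv (F : HC → ℂ) (Z : HC) :
    rho1 cayley⁻¹ F Z =
      -4 * F ((Z - I • (1 : HC)) * (Z + I • (1 : HC))⁻¹) / N (Z + I • (1 : HC)) ^ 2 := by
  have h1 : I • Z + 1 = I • (Z - I • (1 : HC)) := by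
    rw [smul_sub, smul_smul]; simp
  have h2 : I • Z + -1 = I • (Z + I • (1 : HC)) := by
    rw [smul_add, smul_smul]; simp
  have h3 : (-I / 2) • (1 : HC) - Z * ((1 / 2 : ℂ) • (1 : HC)) =
      (-1 / 2 : ℂ) • (Z + I • (1 : HC)) := by
    rw [smul_add, smul_smul, mul_smul_comm, mul_one]; module
  have h4 : (I • (Z - I • (1 : HC))) * (I • (Z + I • (1 : HC)))⁻¹ =
      (Z - I • (1 : HC)) * (Z + I • (1 : HC))⁻¹ := by
    have e : (I • (Z + I • (1 : HC)))⁻¹ = (-I) • (Z + I • (1 : HC))⁻¹ := by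
      by_cases h : IsUnit (Z + I • (1 : HC)).det
      · apply Matrix.inv_eq_right_inv
        rw [smul_mul_smul_comm, Matrix.mul_nonsing_inv _ h]
        simp
      · rw [Matrix.nonsing_inv_apply_not_isUnit _ h, Matrix.nonsing_inv_apply_not_isUnit, smul_zero]
        simpa only [Matrix.det_smul, Fintype.card_fin, I_sq, neg_one_mul, IsUnit.neg_iff] using h
    rw [e, smul_mul_smul_comm]
    simp
  simp only [rho1, cayley, Units.inv_mk, Matrix.of_apply, Matrix.cons_val_zero,
    Matrix.cons_val_one, Matrix.cons_val', Matrix.cons_val_fin_one, smul_mul_assoc, one_mul]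
  rw [h1, h2, h3, h4]
  simp only [N, Matrix.det_smul, Fintype.card_fin, I_sq]
  by_cases h : (Z + I • (1 : HC)).det = 0
  · simp [h]
  · field_simp
    ring

/-! ### The function spaces -/

/-- `G` is regular at infinity if `(ρ₁(0 1; 1 0) G)(Z) = G(Z⁻¹) / N(Z)²`, which makes sense for
invertible `Z` near the origin, extends holomorphically to a neighborhood of the origin. -/
def RegularAtInfinity (G : HC → ℂ) : Prop :=
  ∃ V : Set HC, IsOpen V ∧ (0 : HC) ∈ V ∧ ∃ H : HC → ℂ, DifferentiableOn ℂ H V ∧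
    ∀ Z ∈ V, IsUnit Z → H Z = rho1 inversion G Z

/-- `Zh(𝕄)⁺`: holomorphic functions `F` on `𝕋⁺` such that `ρ₁(γ⁻¹) F` (a function on `𝔻⁺`, which
`Z ↦ (Z - i) (Z + i)⁻¹` maps into `𝕋⁺`) extends holomorphically to a neighborhood of the closure
of `𝔻⁺`. Only the values of `F` on `𝕋⁺` matter. -/
def ZhPlus : Set (HC → ℂ) :=
  {F | DifferentiableOn ℂ F tubePlus ∧
    ∃ U : Set HC, IsOpen U ∧ closure discPlus ⊆ U ∧
      ∃ G : HC → ℂ, DifferentiableOn ℂ G U ∧ Set.EqOn G (rho1 cayley⁻¹ F) discPlus}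

/-- `Zh(𝕄)⁻`: holomorphic functions `F` on `𝕋⁻` such that `ρ₁(γ⁻¹) F` (a function on `𝔻⁻`, which
`Z ↦ (Z - i) (Z + i)⁻¹` maps into `𝕋⁻`) extends to a holomorphic function defined on a neighborhood
of the closure of `𝔻⁻` and regular at infinity. Only the values of `F` on `𝕋⁻` matter. -/
def ZhMinus : Set (HC → ℂ) :=
  {F | DifferentiableOn ℂ F tubeMinus ∧
    ∃ U : Set HC, IsOpen U ∧ closure discMinus ⊆ U ∧
      ∃ G : HC → ℂ, DifferentiableOn ℂ G U ∧ Set.EqOn G (rho1 cayley⁻¹ F) discMinus ∧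
        RegularAtInfinity G}

/-! ### Integration over Minkowski space -/

/-- The positively oriented real basis `ẽ₀, e₁, e₂, e₃` of `𝕄`. -/
def basis : Fin 4 → HC :=
  ![!![-I, 0; 0, -I], !![0, -I; -I, 0], !![0, -1; 1, 0], !![-I, 0; 0, I]]

/-- The point `y⁰ ẽ₀ + y¹ e₁ + y² e₂ + y³ e₃` of `𝕄`. -/
def point (y : Fin 4 → ℝ) : HC := ∑ k, (y k : ℂ) • basis k

/-- `point` parametrizes exactly Minkowski space. -/
theorem range_point : Set.range point = minkowski := by
  ext Z
  constructor
  · rintro ⟨y, rfl⟩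
    show _ᴴ = _
    ext i j
    fin_cases i <;> fin_cases j <;>
      simp [point, basis, Fin.sum_univ_four] <;> ring
  · intro (h : Zᴴ = -Z)
    have h00 := congrFun (congrFun h 0) 0
    have h01 := congrFun (congrFun h 0) 1
    have h11 := congrFun (congrFun h 1) 1
    simp only [Matrix.conjTranspose_apply, Matrix.neg_apply, Complex.ext_iff, RCLike.star_def,
      conj_re, conj_im, neg_re, neg_im] at h00 h01 h11
    refine ⟨![-((Z 0 0).im + (Z 1 1).im) / 2, -(Z 0 1).im, -(Z 0 1).re,
      ((Z 1 1).im - (Z 0 0).im) / 2], ?_⟩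
    ext i j
    fin_cases i <;> fin_cases j <;> apply Complex.ext <;>
      simp [point, basis, Fin.sum_univ_four] <;> linarith

/-- The holomorphic 4-form `dZ⁴ = dz₁₁ ∧ dz₁₂ ∧ dz₂₁ ∧ dz₂₂` (translation invariant), evaluated on
four tangent vectors. -/
def dZ4 (v : Fin 4 → HC) : ℂ :=
  (Matrix.of fun k => ![v k 0 0, v k 0 1, v k 1 0, v k 1 1]).det

theorem dZ4_basis : dZ4 basis = -4 * I := by
  simp [dZ4, basis, Matrix.det_succ_row_zero, Fin.sum_univ_succ, Fin.succAbove]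
  ring_nf

/-- Absolute convergence of `∫_𝕄 f(Z) dZ⁴`. -/
def IntegrableM (f : HC → ℂ) : Prop :=
  Integrable (fun y : Fin 4 → ℝ => f (point y) * dZ4 basis)

/-- `∫_𝕄 f(Z) dZ⁴`, with `𝕄` oriented by `ẽ₀, e₁, e₂, e₃`: the pullback of the form `f(Z) dZ⁴`
under the oriented linear parametrization `y ↦ y⁰ ẽ₀ + y¹ e₁ + y² e₂ + y³ e₃` is
`f(Z(y)) dZ⁴(ẽ₀, e₁, e₂, e₃) dy⁰ ∧ dy¹ ∧ dy² ∧ dy³`. -/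
def integralM (f : HC → ℂ) : ℂ :=
  ∫ y : Fin 4 → ℝ, f (point y) * dZ4 basis

/-- The pairing `⟨F₁, F₂⟩₁ = i / (8π³) ∫_𝕄 F₁(Z) F₂(Z) dZ⁴`. -/
def pairing (F₁ F₂ : HC → ℂ) : ℂ :=
  I / (8 * (Real.pi : ℂ) ^ 3) * integralM (fun Z => F₁ Z * F₂ Z)

end HC

end

namespace HC

open Complex Topology MeasureTheory Filter

/-! ### Positivity of `2 × 2` matrices and the tube domains -/

/-! At `W = -1` the formula is a mean value property. The Cayley transform `V = (1 + Z)(1 - Z)⁻¹`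
maps `𝕋⁺` to `𝔻⁺`, `𝕄` into `U(2)` and `-1` to `0`. Write `F(Z) = 16 f(V) / N(1 - Z)²` with `f =
discForm F`. On `𝕄` the conjugate of `N(1 - Z)` is `N(1 + Z)`, so the integrand `F(Z) / N(Z + 1)²`
equals `16 |N(1 - Z)|⁻⁴ f(V)`. The weight `|N(1 - Z)|⁻⁴` only sees averages of `f` over the circles
`t ↦ tV`, and for holomorphic `f` each of these averages is `f(0) = F(-1)`.

The averaging statement (`poisson_integral`) is proved in explicit coordinates. A point of `𝕄` with
time coordinate `x` and space coordinate `rω` has eigenvalues `-i(x ± r)`. Spherical coordinates in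
space and the substitution `tan` turn the measure into `sin²(a - b) da db` on pairs of eigenvalues
of `V`. This density depends only on `a - b`, so a common rotation of both eigenvalues can be
averaged out (`integral_torusIntegrand`).

The affine maps `Z ↦ A Z A* + B` with `B` in `𝕄` act transitively on `𝕋⁺`, and their Jacobian on `𝕄`
cancels the factor they produce in the kernel; this moves the formula from `-1` to any `W`
(`BoundedHardy.integral_eq`).

These steps are carried out for functions with `f` bounded. In general `f(V)` is replaced by `f(rV)`
with `r < 1`, which is bounded, and `r` tends to `1` under dominated convergence. This requires
control of `f` only near `U(2)` (`reproducing_formula`). That generality handles `𝕋⁻`: the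
reflection `Z ↦ -Z` becomes `V ↦ V⁻¹`, and the given extension then describes `f` only where `V` is
invertible, a region containing `U(2)`. -/

theorem posDef_iff_trace_det {H : HC} (hH : H.IsHermitian) :
    H.PosDef ↔ 0 < H.trace.re ∧ 0 < H.det.re := by
  constructor
  · intro h
    exact ⟨(Complex.lt_def.1 h.trace_pos).1, (Complex.lt_def.1 h.det_pos).1⟩
  · rintro ⟨ht, hd⟩
    have h00 := congrFun (congrFun hH 0) 0
    have h01 := congrFun (congrFun hH 0) 1
    have h11 := congrFun (congrFun hH 1) 1
    simp only [Matrix.conjTranspose_apply, Complex.ext_iff, RCLike.star_def,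
      conj_re, conj_im] at h00 h01 h11
    simp only [Matrix.trace_fin_two, Matrix.det_fin_two, add_re, sub_re, mul_re] at ht hd
    have e10 : (H 1 0).re = (H 0 1).re := by linarith [h01.1]
    have e10' : (H 1 0).im = -(H 0 1).im := by linarith [h01.2]
    have e00 : (H 0 0).im = 0 := by linarith [h00.2]
    have e11 : (H 1 1).im = 0 := by linarith [h11.2]
    rw [e10, e10', e00, e11] at hd
    have ha : 0 < (H 0 0).re := by
      by_contra! h
      nlinarith [sq_nonneg (H 0 1).re, sq_nonneg (H 0 1).im]
    refine Matrix.PosDef.of_dotProduct_mulVec_pos hH fun x hx => ?_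
    have him : (star x ⬝ᵥ (H *ᵥ x)).im = 0 := hH.im_star_dotProduct_mulVec_self x
    refine Complex.lt_def.2 ⟨?_, by simpa using him.symm⟩
    simp only [dotProduct, Matrix.mulVec, Fin.sum_univ_two, Pi.star_apply, RCLike.star_def,
      add_re, mul_re, conj_re, conj_im, add_im, mul_im, zero_re]
    rw [e10, e10', e00, e11]
    clear e10 e10' e00 e11 h00 h01 h11 him
    set a := (H 0 0).re
    set d := (H 1 1).re
    set p := (H 0 1).re
    set q := (H 0 1).im
    set x0 := (x 0).re
    set x1 := (x 0).im
    set y0 := (x 1).re with hy0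
    set y1 := (x 1).im with hy1
    -- Completing the square: `a` times the Hermitian form is `|a x + b y|² + det H · |y|²`, where
    -- `b = p + iq`.
    have key : 0 < (a * x0 + p * y0 - q * y1) ^ 2 + (a * x1 + p * y1 + q * y0) ^ 2 +
        (a * d - p ^ 2 - q ^ 2) * (y0 ^ 2 + y1 ^ 2) := by
      have hD : 0 < a * d - p ^ 2 - q ^ 2 := by nlinarith
      by_cases hy : y0 ^ 2 + y1 ^ 2 = 0
      · have hy0' : y0 = 0 := by nlinarith [sq_nonneg y0, sq_nonneg y1]
        have hy1' : y1 = 0 := by nlinarith [sq_nonneg y0, sq_nonneg y1]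
        have hxx : 0 < x0 ^ 2 + x1 ^ 2 := by
          rcases lt_or_eq_of_le (by positivity : 0 ≤ x0 ^ 2 + x1 ^ 2) with h | h
          · exact h
          · exfalso
            apply hx
            have h0 : x0 = 0 := by nlinarith [sq_nonneg x0, sq_nonneg x1]
            have h1 : x1 = 0 := by nlinarith [sq_nonneg x0, sq_nonneg x1]
            ext i
            fin_cases i
            · exact Complex.ext h0 h1
            · exact Complex.ext hy0' hy1'
        rw [hy0', hy1']
        have := mul_pos (pow_pos ha 2) hxx
        nlinarith
      · have : 0 < y0 ^ 2 + y1 ^ 2 := lt_of_le_of_ne (by positivity) (Ne.symm hy)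
        positivity
    refine pos_of_mul_pos_right (a := a) ?_ ha.le
    refine key.trans_le (le_of_eq ?_)
    ring

theorem posDef_mul_mul_conjTranspose {H R : HC} (hR : R.det ≠ 0) (h : H.PosDef) :
    (R * H * Rᴴ).PosDef :=
  (Matrix.IsUnit.posDef_star_right_conjugate_iff
    ((Matrix.isUnit_iff_isUnit_det _).2 (isUnit_iff_ne_zero.2 hR))).2 h

/-- For `Z = X + iY` one has `-(Z + Z*) = -2iY`, whose trace is `-2i Tr Y` and whose determinant is
`-4 N(Y)`. The two inequalities defining the cone are therefore positivity of trace and determinant.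
-/
theorem mem_tubePlus {Z : HC} : Z ∈ tubePlus ↔ (-(Z + Zᴴ)).PosDef := by
  have hH : (-(Z + Zᴴ)).IsHermitian := by
    simp [Matrix.IsHermitian, Matrix.conjTranspose_add, add_comm]
  rw [posDef_iff_trace_det hH]
  have aux : ∀ X ∈ minkowski, ∀ Y ∈ minkowski, Z = X + I • Y → -(Z + Zᴴ) = (-2 * I) • Y := by
    intro X (hX : Xᴴ = -X) Y (hY : Yᴴ = -Y) h
    rw [h, Matrix.conjTranspose_add, Matrix.conjTranspose_smul, hX, hY]
    simp only [RCLike.star_def, conj_I]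
    module
  have aux2 : ∀ Y : HC, (((-2 * I) • Y).trace.re = -2 * (I * Y.trace).re) ∧
      (((-2 * I) • Y).det.re = -4 * (N Y).re) := by
    intro Y
    constructor
    · simp
    · rw [Matrix.det_smul, Fintype.card_fin]
      have : (-2 * I) ^ 2 = -4 := by rw [mul_pow, I_sq]; norm_num
      rw [this]
      simp [N]
  constructor
  · rintro ⟨X, hX, Y, ⟨hY, h1, h2⟩, h⟩
    rw [aux X hX Y hY h, (aux2 Y).1, (aux2 Y).2]
    constructor <;> linarith
  · intro h
    have hX : ((1 / 2 : ℂ) • (Z - Zᴴ)) ∈ minkowski := by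
      change _ᴴ = _
      rw [Matrix.conjTranspose_smul, Matrix.conjTranspose_sub, Matrix.conjTranspose_conjTranspose]
      simp only [RCLike.star_def, map_div₀, map_one, map_ofNat]
      module
    have hY : ((-I / 2 : ℂ) • (Z + Zᴴ)) ∈ minkowski := by
      change _ᴴ = _
      rw [Matrix.conjTranspose_smul, Matrix.conjTranspose_add, Matrix.conjTranspose_conjTranspose]
      simp only [RCLike.star_def, map_div₀, map_neg, conj_I, map_ofNat]
      module
    have hZ : Z = (1 / 2 : ℂ) • (Z - Zᴴ) + I • ((-I / 2 : ℂ) • (Z + Zᴴ)) := by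
      rw [smul_smul, show I * (-I / 2) = 1 / 2 by linear_combination (-1/2) * I_mul_I]
      module
    rw [aux _ hX _ hY hZ, (aux2 _).1, (aux2 _).2] at h
    exact ⟨_, hX, _, ⟨hY, by linarith [h.2], by linarith [h.1]⟩, hZ⟩

theorem neg_mem_minkowski {Z : HC} : -Z ∈ minkowski ↔ Z ∈ minkowski := by
  simp only [minkowski, Set.mem_ofPred_eq, Matrix.conjTranspose_neg, neg_inj]

theorem mem_tubeMinus {Z : HC} : Z ∈ tubeMinus ↔ -Z ∈ tubePlus := by
  constructor
  · rintro ⟨X, hX, Y, hY, rfl⟩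
    exact ⟨-X, neg_mem_minkowski.2 hX, Y, hY, by module⟩
  · rintro ⟨X, hX, Y, hY, h⟩
    exact ⟨-X, neg_mem_minkowski.2 hX, Y, hY, by rw [← neg_neg Z, h]; module⟩

/-- A null vector `v` of `T` would give `v*(T + T*)v = 0`. The invertibility of `1 - Z` and `V + 1`
in the Cayley transforms rests on this. -/
theorem det_ne_zero_of_posDef_add_conjTranspose {T : HC} (h : (T + Tᴴ).PosDef) : T.det ≠ 0 := by
  intro h0
  obtain ⟨v, hv, hTv⟩ := Matrix.exists_mulVec_eq_zero_iff.2 h0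
  have := h.dotProduct_mulVec_pos hv
  rw [Matrix.add_mulVec, dotProduct_add, hTv, Matrix.dotProduct_mulVec, ← Matrix.star_mulVec,
    hTv] at this
  simp at this

theorem det_one_sub_ne_zero_of_mem_tubePlus {Z : HC} (h : Z ∈ tubePlus) : (1 - Z).det ≠ 0 := by
  apply det_ne_zero_of_posDef_add_conjTranspose
  have := (mem_tubePlus.1 h).add (Matrix.PosDef.one.add (Matrix.PosDef.one (n := Fin 2) (R := ℂ)))
  convert this using 1
  rw [Matrix.conjTranspose_sub, Matrix.conjTranspose_one]
  abel

theorem det_one_sub_ne_zero_of_mem_minkowski {Z : HC} (h : Z ∈ minkowski) : (1 - Z).det ≠ 0 := by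
  apply det_ne_zero_of_posDef_add_conjTranspose
  have h' : Zᴴ = -Z := h
  have := Matrix.PosDef.one.add (Matrix.PosDef.one (n := Fin 2) (R := ℂ))
  convert this using 1
  rw [Matrix.conjTranspose_sub, Matrix.conjTranspose_one, h']
  abel

theorem det_add_one_ne_zero_of_mem_discPlus {V : HC} (h : V ∈ discPlus) : (V + 1).det ≠ 0 := by
  apply det_ne_zero_of_posDef_add_conjTranspose
  have h2 : (V + 1) + (V + 1)ᴴ = (1 - V * Vᴴ) + (V + 1) * (V + 1)ᴴ := by
    rw [Matrix.conjTranspose_add, Matrix.conjTranspose_one]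
    noncomm_ring
  rw [h2]
  exact Matrix.PosDef.add_posSemidef h (Matrix.posSemidef_self_mul_conjTranspose _)

/-! ### The Cayley transform -/

/-- The Cayley transform, mapping `𝕋⁺` to `𝔻⁺` and `𝕄` into `U(2)`. -/
noncomputable def toDisc (Z : HC) : HC := (1 + Z) * (1 - Z)⁻¹

/-- The inverse Cayley transform, mapping `𝔻⁺` to `𝕋⁺`. -/
noncomputable def ofDisc (V : HC) : HC := (V - 1) * (V + 1)⁻¹

theorem toDisc_eq' (Z : HC) : toDisc Z = (1 - Z)⁻¹ * (1 + Z) := by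
  by_cases h : IsUnit (1 - Z).det
  · have e : (1 - Z) * (1 + Z) = (1 + Z) * (1 - Z) := by noncomm_ring
    calc toDisc Z = (1 - Z)⁻¹ * ((1 - Z) * (1 + Z)) * (1 - Z)⁻¹ := by
          rw [Matrix.nonsing_inv_mul_cancel_left _ _ h, toDisc]
      _ = _ := by
          rw [e, mul_assoc, Matrix.mul_nonsing_inv_cancel_right _ _ h]
  · rw [toDisc, Matrix.nonsing_inv_apply_not_isUnit _ h]; simp

theorem ofDisc_eq' (V : HC) : ofDisc V = (V + 1)⁻¹ * (V - 1) := by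
  by_cases h : IsUnit (V + 1).det
  · have e : (V + 1) * (V - 1) = (V - 1) * (V + 1) := by noncomm_ring
    calc ofDisc V = (V + 1)⁻¹ * ((V + 1) * (V - 1)) * (V + 1)⁻¹ := by
          rw [Matrix.nonsing_inv_mul_cancel_left _ _ h, ofDisc]
      _ = _ := by
          rw [e, mul_assoc, Matrix.mul_nonsing_inv_cancel_right _ _ h]
  · rw [ofDisc, Matrix.nonsing_inv_apply_not_isUnit _ h]; simp

theorem toDisc_add_one {Z : HC} (h : (1 - Z).det ≠ 0) : toDisc Z + 1 = (2 : ℂ) • (1 - Z)⁻¹ := by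
  have h1 : (1 - Z) * (1 - Z)⁻¹ = 1 := Matrix.mul_nonsing_inv _ (isUnit_iff_ne_zero.2 h)
  calc toDisc Z + 1 = (1 + Z) * (1 - Z)⁻¹ + (1 - Z) * (1 - Z)⁻¹ := by rw [h1, toDisc]
    _ = (2 : ℂ) • (1 - Z)⁻¹ := by rw [two_smul]; noncomm_ring

theorem det_toDisc_add_one {Z : HC} (h : (1 - Z).det ≠ 0) :
    N (toDisc Z + 1) = 4 / N (1 - Z) := by
  rw [toDisc_add_one h, N, Matrix.det_smul, Fintype.card_fin, Matrix.det_nonsing_inv,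
    Ring.inverse_eq_inv', N]
  norm_num [div_eq_mul_inv]

theorem ofDisc_toDisc {Z : HC} (h : (1 - Z).det ≠ 0) : ofDisc (toDisc Z) = Z := by
  have h1 : (1 - Z) * (1 - Z)⁻¹ = 1 := Matrix.mul_nonsing_inv _ (isUnit_iff_ne_zero.2 h)
  have h2 : toDisc Z - 1 = Z * (toDisc Z + 1) := by
    rw [toDisc_add_one h]
    calc toDisc Z - 1 = (1 + Z) * (1 - Z)⁻¹ - (1 - Z) * (1 - Z)⁻¹ := by rw [h1, toDisc]
      _ = _ := by rw [two_smul]; noncomm_ring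
  rw [ofDisc, h2, mul_assoc, Matrix.mul_nonsing_inv, mul_one]
  have := det_toDisc_add_one h
  rw [N] at this
  rw [isUnit_iff_ne_zero, this]
  exact div_ne_zero (by norm_num) h

/-- With `R = (1 - Z)⁻¹`, the matrix `1 - VV*` is congruent through `R` to `-2(Z + Z*)`. -/
theorem toDisc_mem_discPlus {Z : HC} (h : Z ∈ tubePlus) : toDisc Z ∈ discPlus := by
  have hd := det_one_sub_ne_zero_of_mem_tubePlus h
  have hu : IsUnit (1 - Z).det := isUnit_iff_ne_zero.2 hd
  set R := (1 - Z)⁻¹ with hR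
  have h1 : R * (1 - Z) = 1 := Matrix.nonsing_inv_mul _ hu
  have h2 : (1 - Zᴴ) * Rᴴ = 1 := by
    rw [← Matrix.conjTranspose_one, ← Matrix.conjTranspose_sub, ← Matrix.conjTranspose_mul, h1]
  have e : 1 - toDisc Z * (toDisc Z)ᴴ = R * ((2 : ℂ) • (-(Z + Zᴴ))) * Rᴴ := by
    have h3 : (1 : HC) = R * ((1 - Z) * (1 - Zᴴ)) * Rᴴ := by
      rw [← mul_assoc R, h1, one_mul, h2]
    conv_lhs => lhs; rw [h3]
    rw [toDisc_eq', Matrix.conjTranspose_mul, Matrix.conjTranspose_add, Matrix.conjTranspose_one,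
      ← hR, two_smul]
    noncomm_ring
  change Matrix.PosDef _
  rw [e]
  exact posDef_mul_mul_conjTranspose (Matrix.isUnit_nonsing_inv_det _ hu).ne_zero
    ((mem_tubePlus.1 h).smul two_pos)

theorem ofDisc_mem_tubePlus {V : HC} (h : V ∈ discPlus) : ofDisc V ∈ tubePlus := by
  have hd := det_add_one_ne_zero_of_mem_discPlus h
  have hu : IsUnit (V + 1).det := isUnit_iff_ne_zero.2 hd
  set R := (V + 1)⁻¹ with hR
  have h1 : R * (V + 1) = 1 := Matrix.nonsing_inv_mul _ hu
  have h2 : (Vᴴ + 1) * Rᴴ = 1 := by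
    rw [← Matrix.conjTranspose_one, ← Matrix.conjTranspose_add, ← Matrix.conjTranspose_mul, h1]
  have e : -(ofDisc V + (ofDisc V)ᴴ) = R * ((2 : ℂ) • (1 - V * Vᴴ)) * Rᴴ := by
    have h3 : ofDisc V = R * ((V - 1) * (Vᴴ + 1)) * Rᴴ := by
      rw [ofDisc_eq', ← hR, mul_assoc, mul_assoc, h2, mul_one]
    rw [h3]
    simp only [Matrix.conjTranspose_mul, Matrix.conjTranspose_add, Matrix.conjTranspose_one,
      Matrix.conjTranspose_sub, Matrix.conjTranspose_conjTranspose, two_smul]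
    noncomm_ring
  rw [mem_tubePlus, e]
  exact posDef_mul_mul_conjTranspose (Matrix.isUnit_nonsing_inv_det _ hu).ne_zero
    (Matrix.PosDef.smul h two_pos)

theorem toDisc_mul_conjTranspose {Z : HC} (h : Z ∈ minkowski) : toDisc Z * (toDisc Z)ᴴ = 1 := by
  have hd := det_one_sub_ne_zero_of_mem_minkowski h
  have hZ : Zᴴ = -Z := h
  have hd' : IsUnit (1 + Z).det := by
    have := det_one_sub_ne_zero_of_mem_minkowski (neg_mem_minkowski.2 h)
    rwa [sub_neg_eq_add, ← isUnit_iff_ne_zero] at this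
  rw [toDisc, Matrix.conjTranspose_mul, Matrix.conjTranspose_nonsing_inv, Matrix.conjTranspose_add,
    Matrix.conjTranspose_sub, Matrix.conjTranspose_one, hZ, ← mul_assoc, mul_assoc (1 + Z)]
  rw [← sub_eq_add_neg, sub_neg_eq_add, ← Matrix.mul_inv_rev]
  have e : (1 + Z) * (1 - Z) = (1 - Z) * (1 + Z) := by noncomm_ring
  rw [e, Matrix.mul_inv_rev, ← mul_assoc, Matrix.mul_nonsing_inv _ hd', one_mul,
    Matrix.nonsing_inv_mul _ (isUnit_iff_ne_zero.2 hd)]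

/-! ### A double integral over the torus in Cayley coordinates -/

/-- The one-variable Cayley transform `λ ↦ (1 - iλ)/(1 + iλ)` from the real line to the circle. -/
noncomputable def lineToCircle (s : ℝ) : ℂ := (1 - I * s) / (1 + I * s)

theorem one_add_I_mul_ne_zero (s : ℝ) : (1 + I * s : ℂ) ≠ 0 := by
  intro h
  have := congrArg Complex.re h
  simp at this

theorem norm_lineToCircle (s : ℝ) : ‖lineToCircle s‖ = 1 := by
  have h := one_add_I_mul_ne_zero s
  have e : (1 - I * s : ℂ) = (starRingEnd ℂ) (1 + I * s) := by simp [sub_eq_add_neg]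
  rw [lineToCircle, norm_div, e, RCLike.norm_conj, div_self (norm_ne_zero_iff.2 h)]

theorem continuous_lineToCircle : Continuous lineToCircle := by
  unfold lineToCircle
  exact Continuous.div (by fun_prop) (by fun_prop) one_add_I_mul_ne_zero

theorem lineToCircle_tan {a : ℝ} (ha : Real.cos a ≠ 0) :
    lineToCircle (Real.tan a) = exp ((-2 * a : ℝ) * I) := by
  have hc : (Real.cos a : ℂ) ≠ 0 := by exact_mod_cast ha
  have h1 : (1 + I * (Real.tan a : ℂ)) = exp (a * I) / Real.cos a := by
    rw [exp_mul_I, Real.tan_eq_sin_div_cos]; push_cast at hc ⊢; field_simp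
  have h2 : (1 - I * (Real.tan a : ℂ)) = exp (-a * I) / Real.cos a := by
    rw [exp_mul_I, Real.tan_eq_sin_div_cos, Complex.cos_neg, Complex.sin_neg]
    push_cast at hc ⊢; field_simp; ring
  rw [lineToCircle, h1, h2, div_div_div_cancel_right₀ hc, ← exp_sub]
  congr 1; push_cast; ring

theorem integral_eq_setIntegral_tan {E : Type*} [NormedAddCommGroup E] [NormedSpace ℝ E]
    (f : ℝ → E) : ∫ s, f s =
      ∫ a in Set.Ioo (-(Real.pi / 2)) (Real.pi / 2), (1 + Real.tan a ^ 2) • f (Real.tan a) := by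
  have h := integral_image_eq_integral_abs_deriv_smul (f' := fun a => 1 + Real.tan a ^ 2)
    (f := Real.tan) measurableSet_Ioo (fun x hx => by
      have h1 := (Real.hasDerivAt_tan_of_mem_Ioo hx).hasDerivWithinAt
        (s := Set.Ioo (-(Real.pi / 2)) (Real.pi / 2))
      rwa [one_div, ← Real.inv_one_add_tan_sq (Real.cos_pos_of_mem_Ioo hx).ne', inv_inv] at h1)
    Real.injOn_tan f
  rw [Real.image_tan_Ioo, setIntegral_univ] at h
  rw [h]
  refine setIntegral_congr_fun measurableSet_Ioo fun x _ => ?_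
  rw [abs_of_pos (by positivity)]

/-- The function `φ(e(s), e(t)) (s - t)² / ((1 + s²)² (1 + t²)²)`, where `e` is the Cayley
transform. -/
noncomputable def torusIntegrand (φ : ℂ → ℂ → ℂ) (s t : ℝ) : ℂ :=
  (((s - t) ^ 2 * ((1 + s ^ 2)⁻¹ * (1 + t ^ 2)⁻¹) ^ 2 : ℝ) : ℂ) *
    φ (lineToCircle s) (lineToCircle t)

/-- Since `(s - t)² ≤ 2(1 + s²)(1 + t²)`, one copy of the weight absorbs `(s - t)²` and the other is
integrable in each variable. -/
theorem integrable_torusIntegrand {φ : ℂ → ℂ → ℂ}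
    (hφ : ContinuousOn (Function.uncurry φ) (Metric.sphere 0 1 ×ˢ Metric.sphere 0 1)) :
    Integrable (Function.uncurry (torusIntegrand φ)) := by
  obtain ⟨C, hC⟩ := ((isCompact_sphere (0 : ℂ) 1).prod
    (isCompact_sphere (0 : ℂ) 1)).exists_bound_of_continuousOn hφ
  have hmem : ∀ s, lineToCircle s ∈ Metric.sphere (0 : ℂ) 1 := fun s => by
    simp [norm_lineToCircle]
  have hi : Integrable (fun p : ℝ × ℝ => 2 * C * ((1 + p.1 ^ 2)⁻¹ * (1 + p.2 ^ 2)⁻¹)) :=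
    (integrable_inv_one_add_sq.mul_prod integrable_inv_one_add_sq).const_mul _
  refine hi.mono' (Continuous.aestronglyMeasurable ?_) (Eventually.of_forall ?_)
  · unfold torusIntegrand Function.uncurry
    have h0 : Continuous fun p : ℝ × ℝ => φ (lineToCircle p.1) (lineToCircle p.2) := by
      refine hφ.comp_continuous (f := fun p : ℝ × ℝ => (lineToCircle p.1, lineToCircle p.2)) ?_
        fun p => ⟨hmem _, hmem _⟩
      exact (continuous_lineToCircle.comp continuous_fst).prodMk
        (continuous_lineToCircle.comp continuous_snd)
    refine Continuous.mul (continuous_ofReal.comp ?_) h0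
    have h1 : Continuous fun s : ℝ => (1 + s ^ 2)⁻¹ :=
      Continuous.inv₀ (by fun_prop) fun s => by positivity
    have := h1.comp (continuous_fst (X := ℝ) (Y := ℝ))
    have := h1.comp (continuous_snd (X := ℝ) (Y := ℝ))
    fun_prop
  · rintro ⟨s, t⟩
    have hb := hC (lineToCircle s, lineToCircle t) ⟨hmem _, hmem _⟩
    have hC0 : 0 ≤ C := (norm_nonneg _).trans hb
    simp only [Function.uncurry, torusIntegrand] at hb ⊢
    rw [norm_mul, norm_real, Real.norm_of_nonneg (by positivity)]
    have h1 : (s - t) ^ 2 * ((1 + s ^ 2)⁻¹ * (1 + t ^ 2)⁻¹) ≤ 2 := by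
      rw [← mul_inv, ← div_eq_mul_inv, div_le_iff₀ (by positivity)]
      nlinarith [sq_nonneg (s + t), sq_nonneg (s * t)]
    calc _ = ((s - t) ^ 2 * ((1 + s ^ 2)⁻¹ * (1 + t ^ 2)⁻¹)) *
          ((1 + s ^ 2)⁻¹ * (1 + t ^ 2)⁻¹) * ‖φ (lineToCircle s) (lineToCircle t)‖ := by ring
      _ ≤ 2 * ((1 + s ^ 2)⁻¹ * (1 + t ^ 2)⁻¹) * C := by gcongr
      _ = _ := by ring

/-- The factor `-2` makes an interval of length `π` cover the circle exactly once, backwards. -/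
theorem integral_circle_exp {f : ℂ → ℂ} :
    ∫ b in (-(Real.pi / 2))..(Real.pi / 2), f (exp ((-2 * b : ℝ) * I)) =
      Real.pi * Real.circleAverage f 0 1 := by
  have h1 := intervalIntegral.integral_comp_mul_left (a := -(Real.pi / 2)) (b := Real.pi / 2)
    (c := -2) (fun θ : ℝ => f (exp (θ * I))) (by norm_num)
  have hp : Function.Periodic (fun θ : ℝ => f (exp (θ * I))) (2 * Real.pi) := by
    intro θ
    change f _ = f _
    rw [← exp_periodic (θ * I)]; push_cast; ring_nf
  have h2 := hp.intervalIntegral_add_eq (-Real.pi) 0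
  rw [h1, intervalIntegral.integral_symm, Real.circleAverage_def]
  simp only [circleMap, ofReal_one, one_mul, zero_add]
  rw [zero_add] at h2
  rw [show -2 * (Real.pi / 2) = -Real.pi by ring, show -2 * -(Real.pi / 2) = -Real.pi + 2 * Real.pi by ring,
    h2]
  simp only [real_smul, smul_neg]
  push_cast
  have : (Real.pi : ℂ) ≠ 0 := by exact_mod_cast Real.pi_ne_zero
  field_simp
  simp only [mul_comm I]

/-- Under `s = tan a`, `t = tan b` the weight becomes `sin²(a - b)`. With `a - b` fixed, integration
over `b` rotates both arguments of `φ` simultaneously and gives `πM`; the remaining integral of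
`sin²` over a period is `π/2`. -/
theorem integral_torusIntegrand {φ : ℂ → ℂ → ℂ} {M : ℂ}
    (hφ : ContinuousOn (Function.uncurry φ) (Metric.sphere 0 1 ×ˢ Metric.sphere 0 1))
    (hM : ∀ v ∈ Metric.sphere (0 : ℂ) 1, ∀ w ∈ Metric.sphere (0 : ℂ) 1,
      Real.circleAverage (fun t => φ (t * v) (t * w)) 0 1 = M) :
    ∫ t, ∫ s, torusIntegrand φ s t = (Real.pi ^ 2 / 2 : ℝ) * M := by
  set J := Set.Ioo (-(Real.pi / 2)) (Real.pi / 2) with hJ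
  have hle : -(Real.pi / 2) ≤ Real.pi / 2 := by linarith [Real.pi_pos]
  set e : ℝ → ℂ := fun a => exp ((-2 * a : ℝ) * I) with he
  have hec : Continuous e := by fun_prop
  have hes : ∀ a, e a ∈ Metric.sphere (0 : ℂ) 1 := fun a => by
    rw [mem_sphere_zero_iff_norm]; exact norm_exp_ofReal_mul_I (-2 * a)
  have hee : ∀ a b, e (a + b) = e b * e a := fun a b => by
    simp only [he, ← exp_add]; congr 1; push_cast; ring
  have hper : ∀ a, e (a + Real.pi) = e a := fun a => by
    simp only [he]
    rw [← exp_periodic (((-2 * (a + Real.pi) : ℝ) : ℂ) * I)]; congr 1; push_cast; ring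
  set H : ℝ → ℝ → ℂ := fun a b => ((Real.sin (a - b) ^ 2 : ℝ) : ℂ) * φ (e a) (e b) with hH
  have hHc : Continuous (Function.uncurry H) := by
    have h0 : Continuous fun p : ℝ × ℝ => φ (e p.1) (e p.2) :=
      hφ.comp_continuous (f := fun p : ℝ × ℝ => (e p.1, e p.2)) (by fun_prop)
        fun p => ⟨hes _, hes _⟩
    exact (continuous_ofReal.comp (f := fun p : ℝ × ℝ => Real.sin (p.1 - p.2) ^ 2)
      (by fun_prop)).mul h0
  have step1 : ∫ t, ∫ s, torusIntegrand φ s t = ∫ b in J, ∫ a in J, H a b := by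
    rw [integral_eq_setIntegral_tan]
    refine setIntegral_congr_fun measurableSet_Ioo fun b hb => ?_
    rw [integral_eq_setIntegral_tan, ← integral_smul]
    refine setIntegral_congr_fun measurableSet_Ioo fun a ha => ?_
    have hca := (Real.cos_pos_of_mem_Ioo ha).ne'
    have hcb := (Real.cos_pos_of_mem_Ioo hb).ne'
    simp only [torusIntegrand, hH, he]
    rw [lineToCircle_tan hca, lineToCircle_tan hcb, real_smul, real_smul, ← mul_assoc, ← mul_assoc,
      ← ofReal_mul, ← ofReal_mul]
    congr 2
    rw [Real.inv_one_add_tan_sq hca, Real.inv_one_add_tan_sq hcb, ← inv_inv (1 + Real.tan a ^ 2),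
      ← inv_inv (1 + Real.tan b ^ 2), Real.inv_one_add_tan_sq hca, Real.inv_one_add_tan_sq hcb,
      Real.sin_sub, Real.tan_eq_sin_div_cos, Real.tan_eq_sin_div_cos]
    field_simp
  have toI : ∀ f : ℝ → ℂ, ∫ a in J, f a = ∫ a in (-(Real.pi / 2))..(Real.pi / 2), f a := by
    intro f
    rw [intervalIntegral.integral_of_le hle, integral_Ioc_eq_integral_Ioo]
  -- The integrand is `π`-periodic in `a`, so the window of length `π` may be translated by `b`.
  have step2 : ∀ b, ∫ a in J, H a b = ∫ a in J, H (a + b) b := by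
    intro b
    rw [toI, toI, intervalIntegral.integral_comp_add_right (fun a => H a b)]
    have hp : Function.Periodic (fun a => H a b) Real.pi := by
      intro a
      simp only [hH]
      rw [hper, show a + Real.pi - b = a - b + Real.pi by ring, Real.sin_add_pi, neg_sq]
    have := hp.intervalIntegral_add_eq (-(Real.pi / 2)) (-(Real.pi / 2) + b)
    rw [show -(Real.pi / 2) + Real.pi = Real.pi / 2 by ring,
      show -(Real.pi / 2) + b + Real.pi = Real.pi / 2 + b by ring] at this
    exact this
  rw [step1]
  simp_rw [step2]
  rw [integral_integral_swap]
  · have : ∀ a, ∫ b in J, H (a + b) b = ((Real.sin a ^ 2 : ℝ) : ℂ) * (Real.pi * M) := by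
      intro a
      simp only [hH, add_sub_cancel_right]
      rw [integral_const_mul, toI]
      congr 1
      have h3 := integral_circle_exp (f := fun t => φ (t * e a) (t * 1))
      rw [hM (e a) (hes a) 1 (by simp)] at h3
      rw [← h3]
      refine intervalIntegral.integral_congr fun b _ => ?_
      simp only [hee, mul_one]
      rfl
    simp_rw [this]
    rw [integral_mul_const, toI, intervalIntegral.integral_ofReal, integral_sin_sq]
    simp only [Real.sin_neg, Real.cos_neg, Real.cos_pi_div_two]
    push_cast
    ring
  · have h4 : Continuous (Function.uncurry fun b a => H (a + b) b) := by
      exact hHc.comp (f := fun p : ℝ × ℝ => (p.2 + p.1, p.1)) (by fun_prop)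
    rw [Measure.prod_restrict]
    refine (h4.continuousOn.integrableOn_compact (K := Set.Icc (-(Real.pi / 2)) (Real.pi / 2) ×ˢ
      Set.Icc (-(Real.pi / 2)) (Real.pi / 2)) (isCompact_Icc.prod isCompact_Icc)).mono_set ?_
    exact Set.prod_mono Set.Ioo_subset_Icc_self Set.Ioo_subset_Icc_self

/-- The integral of `torusIntegrand` in the coordinates `s = x + r`, `t = x - r`. -/
theorem integral_slice {φ : ℂ → ℂ → ℂ} {M : ℂ}
    (hφ : ContinuousOn (Function.uncurry φ) (Metric.sphere 0 1 ×ˢ Metric.sphere 0 1))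
    (hM : ∀ v ∈ Metric.sphere (0 : ℂ) 1, ∀ w ∈ Metric.sphere (0 : ℂ) 1,
      Real.circleAverage (fun t => φ (t * v) (t * w)) 0 1 = M) :
    Integrable (fun r : ℝ => ∫ x, torusIntegrand φ (x + r) (x - r)) ∧
    ∫ r : ℝ, ∫ x, torusIntegrand φ (x + r) (x - r) = (Real.pi ^ 2 / 4 : ℝ) * M := by
  have hmp : MeasurePreserving (fun p : ℝ × ℝ => (p.2 + p.1, p.2)) :=
    Measure.measurePreserving_swap.comp (measurePreserving_prod_add_swap volume volume)
  have hi : Integrable (fun p : ℝ × ℝ => torusIntegrand φ (p.2 + p.1) p.2) :=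
    hmp.integrable_comp_of_integrable (integrable_torusIntegrand hφ)
  -- Translating `x` by `r` replaces `(x + r, x - r)` by `(t + 2r, t)`. The scaling `q = 2r` then
  -- accounts for the factor `1/2` relative to `integral_torusIntegrand`.
  have e1 : (fun r : ℝ => ∫ x, torusIntegrand φ (x + r) (x - r)) =
      fun r => (fun q => ∫ t, torusIntegrand φ (t + q) t) (2 * r) := by
    ext r
    refine Eq.trans ?_ (integral_sub_right_eq_self (fun t => torusIntegrand φ (t + 2 * r) t) r)
    congr 1; ext x; congr 1; ring
  rw [e1]
  refine ⟨hi.integral_prod_left.comp_mul_left' two_ne_zero, ?_⟩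
  rw [Measure.integral_comp_mul_left (fun q => ∫ t, torusIntegrand φ (t + q) t),
    integral_integral_swap hi]
  have e2 : ∀ t, ∫ q, torusIntegrand φ (t + q) t = ∫ s, torusIntegrand φ s t := fun t =>
    integral_add_left_eq_self (fun s => torusIntegrand φ s t) t
  simp_rw [e2]
  rw [integral_torusIntegrand hφ hM, abs_of_pos (by positivity), real_smul]
  push_cast; ring

/-! ### Spherical coordinates -/

section Polar

variable {E : Type*} [NormedAddCommGroup E] [NormedSpace ℝ E] [MeasurableSpace E] [BorelSpace E]
  [FiniteDimensional ℝ E] [Nontrivial E] (μ : Measure E) [μ.IsAddHaarMeasure]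
  {F : Type*} [NormedAddCommGroup F] [NormedSpace ℝ F]

theorem integral_polar {m : E → F} (hm : Integrable m μ) :
    ∫ x, m x ∂μ = ∫ ω : Metric.sphere (0 : E) 1, (∫ r in Set.Ioi (0 : ℝ),
      r ^ (Module.finrank ℝ E - 1) • m (r • (ω : E))) ∂μ.toSphere := by
  have hmp := μ.measurePreserving_homeomorphUnitSphereProd
  have hemb := (homeomorphUnitSphereProd E).measurableEmbedding
  set f : Metric.sphere (0 : E) 1 × Set.Ioi (0 : ℝ) → F := fun p => m (p.2.1 • p.1.1) with hf
  have hfm : ∀ x : ({(0 : E)}ᶜ : Set E), f (homeomorphUnitSphereProd E x) = m x := by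
    intro x
    simp only [hf]
    rw [← homeomorphUnitSphereProd_symm_apply_coe, Homeomorph.symm_apply_apply]
  have hi : Integrable f (μ.toSphere.prod (.volumeIoiPow (Module.finrank ℝ E - 1))) := by
    rw [← hmp.integrable_comp_emb hemb]
    simp only [Function.comp_def, hfm]
    have h1 := (integrableOn_iff_comap_subtypeVal (μ := μ) (f := m)
      (measurableSet_singleton (0 : E)).compl).1 hm.integrableOn
    exact h1
  calc ∫ x, m x ∂μ = ∫ x : ({(0)}ᶜ : Set E), m x ∂(μ.comap (↑)) := by
        rw [integral_subtype_comap (measurableSet_singleton _).compl fun x ↦ m x,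
          restrict_compl_singleton]
    _ = ∫ p, f p ∂μ.toSphere.prod (.volumeIoiPow (Module.finrank ℝ E - 1)) := by
        rw [← hmp.integral_comp hemb]
        simp only [hfm]
    _ = ∫ ω : Metric.sphere (0 : E) 1, (∫ r : Set.Ioi (0 : ℝ), m (r.1 • ω.1)
          ∂.volumeIoiPow (Module.finrank ℝ E - 1)) ∂μ.toSphere := integral_prod _ hi
    _ = _ := by
        congr 1
        ext ω
        simp only [Measure.volumeIoiPow, ENNReal.ofReal]
        rw [integral_withDensity_eq_integral_smul
            ((measurable_subtype_coe.pow_const _).real_toNNReal),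
          integral_subtype_comap measurableSet_Ioi
            fun a ↦ Real.toNNReal (a ^ (Module.finrank ℝ E - 1)) • m (a • (ω : E)),
          setIntegral_congr_fun measurableSet_Ioi fun x hx ↦ ?_]
        rw [NNReal.smul_def, Real.coe_toNNReal _ (pow_nonneg hx.out.le _)]

/-- If the weighted integrals of `m` along all lines through the origin agree, they determine
the integral of `m`. -/
theorem integral_of_lines [CompleteSpace F] (hd : Even (Module.finrank ℝ E - 1)) {m : E → F}
    (hm : Integrable m μ) {X : F}
    (h : ∀ ω : E, ‖ω‖ = 1 →
      Integrable (fun r : ℝ => r ^ (Module.finrank ℝ E - 1) • m (r • ω)) ∧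
      ∫ r : ℝ, r ^ (Module.finrank ℝ E - 1) • m (r • ω) = X) :
    ∫ x, m x ∂μ = (2⁻¹ * μ.toSphere.real Set.univ) • X := by
  -- Adding the reflected function makes every ray integral a full line integral, because the radial
  -- weight has even exponent. The total integral doubles, hence the `2⁻¹` in the conclusion.
  have h1 := integral_polar μ (hm.add hm.comp_neg)
  have h2 : ∀ ω : Metric.sphere (0 : E) 1, ∫ r in Set.Ioi (0 : ℝ),
      r ^ (Module.finrank ℝ E - 1) • (m + fun x => m (-x)) (r • (ω : E)) = X := by
    intro ω
    obtain ⟨hi, hX⟩ := h ω (by simp)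
    have hneg := integral_comp_neg_Ioi (0 : ℝ)
      fun r : ℝ => r ^ (Module.finrank ℝ E - 1) • m (r • (ω : E))
    have hin := hi.comp_neg
    simp only [hd.neg_pow, neg_smul, neg_zero] at hneg hin
    simp only [Pi.add_apply, smul_add]
    rw [integral_add hi.integrableOn hin.integrableOn, hneg, add_comm,
      ← hX, ← setIntegral_univ (μ := volume), ← Set.Iic_union_Ioi (a := (0 : ℝ)),
      setIntegral_union (Set.Iic_disjoint_Ioi le_rfl) measurableSet_Ioi hi.integrableOn
        hi.integrableOn]
  simp_rw [h2] at h1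
  rw [integral_const] at h1
  have h3 : ∫ x, (m + fun x => m (-x)) x ∂μ = (2 : ℝ) • ∫ x, m x ∂μ := by
    simp only [Pi.add_apply]
    rw [integral_add hm hm.comp_neg, integral_neg_eq_self, two_smul]
  rw [mul_smul, ← h1, h3, smul_smul]
  norm_num

end Polar

/-- Euclidean three-space. -/
abbrev E3 : Type := EuclideanSpace ℝ (Fin 3)

/-- The constant is half of the area `4π` of the unit sphere: every line through the origin meets
the sphere twice. -/
theorem integral_E3_of_lines {m : E3 → ℂ} (hm : Integrable m) {X : ℂ}
    (h : ∀ ω : E3, ‖ω‖ = 1 → Integrable (fun r : ℝ => r ^ 2 • m (r • ω)) ∧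
      ∫ r : ℝ, r ^ 2 • m (r • ω) = X) :
    ∫ x, m x = (2 * Real.pi : ℝ) • X := by
  have hf : Module.finrank ℝ E3 - 1 = 2 := by simp
  rw [integral_of_lines volume (by rw [hf]; decide) hm (X := X) (by rw [hf]; exact h),
    Measure.toSphere_real_apply_univ, Measure.real, EuclideanSpace.volume_ball_fin_three]
  congr 1
  rw [finrank_euclideanSpace_fin]
  rw [ENNReal.toReal_mul, ENNReal.toReal_ofReal (by positivity)]
  simp
  ring

/-! ### The Poisson integral at the origin -/

theorem isCompact_norm_entries_le (R : ℝ) : IsCompact {V : HC | ∀ i j, ‖V i j‖ ≤ R} := by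
  have h := isCompact_univ_pi (X := fun _ : Fin 2 => Fin 2 → ℂ) fun _ =>
    isCompact_univ_pi fun _ : Fin 2 => isCompact_closedBall (0 : ℂ) R
  have e : {V : HC | ∀ i j, ‖V i j‖ ≤ R} = Set.univ.pi fun _ : Fin 2 =>
      Set.univ.pi fun _ : Fin 2 => Metric.closedBall (0 : ℂ) R := by
    ext V
    change (∀ i j, ‖V i j‖ ≤ R) ↔ ∀ i ∈ Set.univ, ∀ j ∈ Set.univ, V i j ∈ Metric.closedBall 0 R
    simp
  rw [e]; exact h

/-- The unitary group `U(2)`, as a subset of `ℍ_ℂ`. -/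
def unitarySet : Set HC := {V | V * Vᴴ = 1}

/-- The diagonal entries of `r² - VV*` are `r²` minus the squared norms of the rows of `V`. -/
theorem norm_entry_le {V : HC} {r : ℝ} (hr : 0 ≤ r)
    (h : (((r ^ 2 : ℝ) : ℂ) • (1 : HC) - V * Vᴴ).PosSemidef) (i j : Fin 2) : ‖V i j‖ ≤ r := by
  have h1 := (Complex.le_def.1 (h.diag_nonneg (i := i))).1
  have h2 : ((((r ^ 2 : ℝ) : ℂ) • (1 : HC) - V * Vᴴ) i i).re =
      r ^ 2 - (‖V i 0‖ ^ 2 + ‖V i 1‖ ^ 2) := by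
    simp [Matrix.mul_apply, Fin.sum_univ_two, ← Complex.normSq_eq_norm_sq, mul_conj]
    rw [← ofReal_pow, ofReal_re]
  rw [h2, zero_re] at h1
  refine abs_le_of_sq_le_sq' ?_ hr |>.2
  fin_cases j
  · change ‖V i 0‖ ^ 2 ≤ _
    nlinarith [sq_nonneg ‖V i 1‖]
  · change ‖V i 1‖ ^ 2 ≤ _
    nlinarith [sq_nonneg ‖V i 0‖]

theorem isCompact_unitarySet : IsCompact unitarySet := by
  refine (isCompact_norm_entries_le 1).of_isClosed_subset ?_ ?_
  · exact isClosed_eq (by fun_prop) continuous_const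
  · intro V (hV : _ = _) i j
    refine norm_entry_le zero_le_one ?_ i j
    rw [hV]; simp [Matrix.PosSemidef.zero]

/-- The identification of `ℝ × ℝ³` with `ℝ⁴`. -/
noncomputable def join (p : ℝ × E3) : Fin 4 → ℝ := ![p.1, p.2 0, p.2 1, p.2 2]

theorem measurePreserving_join : MeasurePreserving join := by
  have h1 := (volume_preserving_piFinSuccAbove (fun _ : Fin 4 => ℝ) 0).symm
  have h2 := (MeasurePreserving.id (volume : Measure ℝ)).prod
    (PiLp.volume_preserving_ofLp (Fin 3))
  have e : join = (MeasurableEquiv.piFinSuccAbove (fun _ : Fin 4 => ℝ) 0).symm ∘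
      Prod.map id (WithLp.ofLp) := by
    ext p i
    fin_cases i <;> simp [join, MeasurableEquiv.piFinSuccAbove] <;> rfl
  rw [e]
  exact h1.comp h2

theorem measurableEmbedding_join : MeasurableEmbedding join := by
  have h1 := (MeasurableEquiv.piFinSuccAbove (fun _ : Fin 4 => ℝ) 0).symm.measurableEmbedding
  have h2 := ((MeasurableEquiv.refl ℝ).prodCongr
    (MeasurableEquiv.toLp 2 (Fin 3 → ℝ)).symm).measurableEmbedding
  convert h1.comp h2 using 1
  ext p i
  fin_cases i <;> simp [join, MeasurableEquiv.piFinSuccAbove] <;> rfl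

/-- The Hermitian matrix `ω¹ σ₁ + ω² σ₂ + ω³ σ₃`. -/
noncomputable def spin (ω : E3) : HC := I • point (join (0, ω))

theorem spin_eq (ω : E3) : spin ω = !![(ω 2 : ℂ), ω 0 - I * ω 1; ω 0 + I * ω 1, -(ω 2 : ℂ)] := by
  ext i j
  fin_cases i <;> fin_cases j <;>
    simp [spin, point, basis, join, Fin.sum_univ_four] <;> ring_nf <;> simp

theorem point_join (x : ℝ) (r : ℝ) (ω : E3) :
    point (join (x, r • ω)) = (-I * x) • (1 : HC) + (-I * r) • spin ω := by
  rw [spin_eq]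
  ext i j
  fin_cases i <;> fin_cases j <;>
    simp [point, basis, join, Fin.sum_univ_four] <;> ring_nf <;> simp <;> ring

theorem spin_mul_spin {ω : E3} (h : ‖ω‖ = 1) : spin ω * spin ω = 1 := by
  have h1 : ω 0 ^ 2 + ω 1 ^ 2 + ω 2 ^ 2 = 1 := by
    have := EuclideanSpace.real_norm_sq_eq ω
    rw [h, Fin.sum_univ_three] at this
    linarith
  have h2 : (ω 0 : ℂ) ^ 2 + (ω 1 : ℂ) ^ 2 + (ω 2 : ℂ) ^ 2 = 1 := by
    have := congrArg (fun t : ℝ => (t : ℂ)) h1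
    push_cast at this
    exact this
  rw [spin_eq]
  ext i j
  fin_cases i <;> fin_cases j <;> simp [Matrix.mul_apply, Fin.sum_univ_two]
  · linear_combination h2 - (ω 1 : ℂ) ^ 2 * I_sq
  · ring
  · ring
  · linear_combination h2 - (ω 1 : ℂ) ^ 2 * I_sq

theorem conjTranspose_spin (ω : E3) : (spin ω)ᴴ = spin ω := by
  rw [spin_eq]
  ext i j
  fin_cases i <;> fin_cases j <;> simp [Matrix.conjTranspose_apply, sub_eq_add_neg]

/-- The matrix with eigenvalues `v`, `w` on the eigenspaces of `spin ω`. -/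
noncomputable def spectralPoint (ω : E3) (v w : ℂ) : HC :=
  ((v + w) / 2) • (1 : HC) + ((v - w) / 2) • spin ω

/-- `spin ω` is an involution, so `(1 ± spin ω)/2` are complementary projections and the
coefficients multiply as eigenvalues. -/
theorem spectralPoint_mul {ω : E3} (h : ‖ω‖ = 1) (v w v' w' : ℂ) :
    spectralPoint ω v w * spectralPoint ω v' w' = spectralPoint ω (v * v') (w * w') := by
  simp only [spectralPoint, add_mul, mul_add, smul_mul_assoc, mul_smul_comm, one_mul, mul_one,
    spin_mul_spin h]
  module

theorem conjTranspose_spectralPoint (ω : E3) (v w : ℂ) :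
    (spectralPoint ω v w)ᴴ = spectralPoint ω (star v) (star w) := by
  simp only [spectralPoint, Matrix.conjTranspose_add, Matrix.conjTranspose_smul,
    Matrix.conjTranspose_one, conjTranspose_spin]
  simp

theorem spectralPoint_self (ω : E3) (v : ℂ) : spectralPoint ω v v = v • (1 : HC) := by
  simp [spectralPoint]

theorem smul_spectralPoint (ω : E3) (c v w : ℂ) :
    c • spectralPoint ω v w = spectralPoint ω (c * v) (c * w) := by
  simp only [spectralPoint]; module

theorem spectralPoint_mem_unitarySet {ω : E3} (h : ‖ω‖ = 1) {v w : ℂ} (hv : ‖v‖ = 1)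
    (hw : ‖w‖ = 1) : spectralPoint ω v w ∈ unitarySet := by
  change _ * _ = _
  have aux : ∀ z : ℂ, ‖z‖ = 1 → z * star z = 1 := fun z hz => by
    rw [RCLike.star_def, mul_conj, Complex.normSq_eq_norm_sq, hz]; simp
  rw [conjTranspose_spectralPoint, spectralPoint_mul h, aux v hv, aux w hw, spectralPoint_self,
    one_smul]

theorem continuous_spectralPoint (ω : E3) :
    Continuous fun p : ℂ × ℂ => spectralPoint ω p.1 p.2 := by
  unfold spectralPoint; fun_prop

theorem point_join_eq_spectralPoint (x r : ℝ) (ω : E3) :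
    point (join (x, r • ω)) = spectralPoint ω (-I * (x + r : ℝ)) (-I * (x - r : ℝ)) := by
  rw [point_join, spectralPoint]; push_cast; module

theorem one_sub_spectralPoint (ω : E3) (v w : ℂ) :
    1 - spectralPoint ω v w = spectralPoint ω (1 - v) (1 - w) := by
  simp only [spectralPoint]; module

theorem one_add_spectralPoint (ω : E3) (v w : ℂ) :
    1 + spectralPoint ω v w = spectralPoint ω (1 + v) (1 + w) := by
  simp only [spectralPoint]; module

theorem point_mem_minkowski (y : Fin 4 → ℝ) : point y ∈ minkowski := by
  rw [← range_point]; exact Set.mem_range_self y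

/-- The Cayley transform acts on eigenvalues: `-is` goes to `(1 - is)/(1 + is)`, and here `s = x ±
r`. -/
theorem toDisc_point_join (x r : ℝ) {ω : E3} (h : ‖ω‖ = 1) :
    toDisc (point (join (x, r • ω))) =
      spectralPoint ω (lineToCircle (x + r)) (lineToCircle (x - r)) := by
  have hd := det_one_sub_ne_zero_of_mem_minkowski (point_mem_minkowski (join (x, r • ω)))
  have hne : ∀ s : ℝ, lineToCircle s * (1 - -I * s) = 1 + -I * s := fun s => by
    have := one_add_I_mul_ne_zero s
    rw [lineToCircle]; field_simp; ring
  have e : 1 + point (join (x, r • ω)) =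
      spectralPoint ω (lineToCircle (x + r)) (lineToCircle (x - r)) *
        (1 - point (join (x, r • ω))) := by
    rw [point_join_eq_spectralPoint, one_sub_spectralPoint, one_add_spectralPoint,
      spectralPoint_mul h, hne, hne]
  rw [toDisc, e, mul_assoc, Matrix.mul_nonsing_inv _ (isUnit_iff_ne_zero.2 hd), mul_one]

theorem N_one_sub_point_join (x : ℝ) (v : E3) :
    N (1 - point (join (x, v))) = (1 + I * (x + ‖v‖ : ℝ)) * (1 + I * (x - ‖v‖ : ℝ)) := by
  have h1 : (v 0 : ℂ) ^ 2 + (v 1 : ℂ) ^ 2 + (v 2 : ℂ) ^ 2 = (‖v‖ : ℂ) ^ 2 := by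
    have := EuclideanSpace.real_norm_sq_eq v
    rw [Fin.sum_univ_three] at this
    exact_mod_cast this.symm
  simp [N, Matrix.det_fin_two, point, basis, join, Fin.sum_univ_four]
  linear_combination h1 + ((v 0 : ℂ) ^ 2 + (v 2 : ℂ) ^ 2 - (‖v‖ : ℂ) ^ 2) * (-I_sq)

theorem norm_N_one_sub_point_join (x : ℝ) (v : E3) :
    ‖N (1 - point (join (x, v)))‖ ^ 2 = (1 + (x + ‖v‖) ^ 2) * (1 + (x - ‖v‖) ^ 2) := by
  have aux : ∀ s : ℝ, ‖1 + I * (s : ℂ)‖ ^ 2 = 1 + s ^ 2 := fun s => by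
    rw [← Complex.normSq_eq_norm_sq, Complex.normSq_apply]; simp; ring
  rw [N_one_sub_point_join, norm_mul, mul_pow, aux, aux]

/-- The weight `|N(1 - Z)|⁻⁴`, the Poisson kernel at `-1`. -/
noncomputable def weight (y : Fin 4 → ℝ) : ℝ := (‖N (1 - point y)‖ ^ 4)⁻¹

theorem weight_join (x : ℝ) (v : E3) :
    weight (join (x, v)) = ((1 + (x + ‖v‖) ^ 2)⁻¹ * (1 + (x - ‖v‖) ^ 2)⁻¹) ^ 2 := by
  rw [weight, ← mul_inv, ← norm_N_one_sub_point_join, inv_pow, ← pow_mul]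

theorem continuous_point : Continuous point := by
  unfold point; fun_prop

theorem continuous_N : Continuous N := by
  unfold N; fun_prop

theorem N_one_sub_point_ne_zero (y : Fin 4 → ℝ) : N (1 - point y) ≠ 0 :=
  det_one_sub_ne_zero_of_mem_minkowski (point_mem_minkowski y)

theorem continuous_weight : Continuous weight := by
  refine Continuous.inv₀ ?_ fun y => pow_ne_zero 4 (norm_ne_zero_iff.2 (N_one_sub_point_ne_zero y))
  exact ((continuous_N.comp (continuous_const.sub continuous_point)).norm).pow 4

theorem weight_nonneg (y : Fin 4 → ℝ) : 0 ≤ weight y := by unfold weight; positivity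

/-- Integrating over `x` first gives `π`, by translation invariance. What remains is `(1 + ‖v‖²)⁻²`,
integrable on three-space because `4 > 3`. -/
theorem integrable_mul_inv_one_add_sq_add_norm (c : ℝ) :
    Integrable fun p : ℝ × E3 => ((1 + ‖p.2‖ ^ 2)⁻¹) ^ 2 * (1 + (p.1 + c * ‖p.2‖) ^ 2)⁻¹ := by
  have hc : Continuous fun p : ℝ × E3 =>
      ((1 + ‖p.2‖ ^ 2)⁻¹) ^ 2 * (1 + (p.1 + c * ‖p.2‖) ^ 2)⁻¹ := by
    refine Continuous.mul (Continuous.pow (Continuous.inv₀ (by fun_prop) fun p => by positivity) 2)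
      (Continuous.inv₀ (by fun_prop) fun p => by positivity)
  refine (integrable_prod_iff' hc.aestronglyMeasurable).2 ⟨Eventually.of_forall fun v => ?_, ?_⟩
  · exact (integrable_inv_one_add_sq.comp_add_right (c * ‖v‖)).const_mul (((1 + ‖v‖ ^ 2)⁻¹) ^ 2)
  · have h1 : ∀ v : E3, ∫ x : ℝ, ‖((1 + ‖v‖ ^ 2)⁻¹) ^ 2 * (1 + (x + c * ‖v‖) ^ 2)⁻¹‖ =
        Real.pi * (1 + ‖v‖ ^ 2) ^ (-(4 : ℝ) / 2) := by
      intro v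
      have : ∀ x : ℝ, ‖((1 + ‖v‖ ^ 2)⁻¹) ^ 2 * (1 + (x + c * ‖v‖) ^ 2)⁻¹‖ =
          ((1 + ‖v‖ ^ 2)⁻¹) ^ 2 * (1 + (x + c * ‖v‖) ^ 2)⁻¹ := fun x =>
        Real.norm_of_nonneg (by positivity)
      simp_rw [this]
      rw [integral_const_mul, integral_add_right_eq_self (fun x : ℝ => (1 + x ^ 2)⁻¹),
        integral_univ_inv_one_add_sq, mul_comm]
      congr 1
      rw [show (-(4 : ℝ) / 2) = -((2 : ℕ) : ℝ) by norm_num, Real.rpow_neg (by positivity),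
        Real.rpow_natCast, inv_pow]
    simp_rw [h1]
    exact (integrable_rpow_neg_one_add_norm_sq (by rw [finrank_euclideanSpace_fin]; norm_num)).const_mul _

/-- With `A = 1 + (x + r)²` and `B = 1 + (x - r)²`, both `AB` and `A + B` are at least `1 + r²`.
Hence `(AB)⁻² ≤ (1 + r²)⁻² (A⁻¹ + B⁻¹)`, a sum of two functions of the preceding kind. -/
theorem integrable_weight : Integrable weight := by
  rw [← measurePreserving_join.integrable_comp_emb measurableEmbedding_join]
  have hj : Continuous join := by unfold join; fun_prop
  refine ((integrable_mul_inv_one_add_sq_add_norm 1).add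
    (integrable_mul_inv_one_add_sq_add_norm (-1))).mono'
    (continuous_weight.comp hj).aestronglyMeasurable (Eventually.of_forall ?_)
  rintro ⟨x, v⟩
  simp only [Function.comp_apply, Pi.add_apply]
  rw [Real.norm_of_nonneg (weight_nonneg _), weight_join]
  set r := ‖v‖
  have ea : x + 1 * r = x + r := by ring
  have eb : x + -1 * r = x - r := by ring
  rw [ea, eb]
  set A := 1 + (x + r) ^ 2 with hA
  set B := 1 + (x - r) ^ 2 with hB
  have hA1 : 1 ≤ A := by nlinarith [sq_nonneg (x + r)]
  have hB1 : 1 ≤ B := by nlinarith [sq_nonneg (x - r)]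
  have hAp : 0 < A := by linarith
  have hBp : 0 < B := by linarith
  have hAB : A + B = 2 * (1 + r ^ 2) + 2 * x ^ 2 := by rw [hA, hB]; ring
  have h1 : A⁻¹ * B⁻¹ ≤ (1 + r ^ 2)⁻¹ := by
    rw [← mul_inv]
    apply inv_anti₀ (by positivity)
    nlinarith [mul_nonneg (sub_nonneg.2 hA1) (sub_nonneg.2 hB1), sq_nonneg x, sq_nonneg r]
  have h2 : A⁻¹ * B⁻¹ ≤ (1 + r ^ 2)⁻¹ * (A⁻¹ + B⁻¹) := by
    have : A⁻¹ + B⁻¹ = (A + B) * (A⁻¹ * B⁻¹) := by field_simp; ring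
    rw [this, ← mul_assoc]
    refine le_mul_of_one_le_left (by positivity) ?_
    rw [inv_mul_eq_div, le_div_iff₀ (by positivity), hAB]
    nlinarith [sq_nonneg x, sq_nonneg r]
  calc (A⁻¹ * B⁻¹) ^ 2 = (A⁻¹ * B⁻¹) * (A⁻¹ * B⁻¹) := sq _
    _ ≤ (1 + r ^ 2)⁻¹ * ((1 + r ^ 2)⁻¹ * (A⁻¹ + B⁻¹)) := by gcongr
    _ = _ := by ring

theorem toDisc_point_mem_unitarySet (y : Fin 4 → ℝ) : toDisc (point y) ∈ unitarySet :=
  toDisc_mul_conjTranspose (point_mem_minkowski y)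

theorem continuous_toDisc_point : Continuous fun y => toDisc (point y) := by
  have h : ∀ y, toDisc (point y) =
      (1 + point y) * ((N (1 - point y))⁻¹ • (1 - point y).adjugate) := by
    intro y
    rw [toDisc, Matrix.inv_def, Ring.inverse_eq_inv', N]
  simp_rw [h]
  have hp := continuous_point
  have hn : Continuous fun y => (N (1 - point y))⁻¹ :=
    Continuous.inv₀ (continuous_N.comp (continuous_const.sub continuous_point))
      N_one_sub_point_ne_zero
  exact (continuous_const.add hp).mul (hn.smul (continuous_const.sub hp).matrix_adjugate)

/-- Along a fixed direction `ω` put `s = x + r`, `t = x - r`; then `r² = (s - t)²/4`, so the line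
integral is a quarter of the one in `integral_slice`, namely `π²M/16`. Multiplication by `2π` gives
`π³M/8`. -/
theorem poisson_integral {g : HC → ℂ} {M : ℂ} (hg : ContinuousOn g unitarySet)
    (hM : ∀ V ∈ unitarySet, Real.circleAverage (fun t => g (t • V)) 0 1 = M) :
    Integrable (fun y => (weight y : ℂ) * g (toDisc (point y))) ∧
    ∫ y, (weight y : ℂ) * g (toDisc (point y)) = (Real.pi ^ 3 / 8 : ℝ) * M := by
  have hi : Integrable (fun y => (weight y : ℂ) * g (toDisc (point y))) := by
    obtain ⟨C, hC⟩ := isCompact_unitarySet.exists_bound_of_continuousOn hg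
    refine integrable_weight.ofReal.mul_bdd (c := C) ?_ (Eventually.of_forall fun y =>
      hC _ (toDisc_point_mem_unitarySet y))
    exact (hg.comp_continuous continuous_toDisc_point
      toDisc_point_mem_unitarySet).aestronglyMeasurable
  refine ⟨hi, ?_⟩
  have hi' : Integrable (fun p : ℝ × E3 => (weight (join p) : ℂ) * g (toDisc (point (join p)))) :=
    (measurePreserving_join.integrable_comp_emb measurableEmbedding_join).2 hi
  rw [← measurePreserving_join.integral_comp measurableEmbedding_join]
  rw [Measure.volume_eq_prod]
  rw [integral_prod_symm _ hi', integral_E3_of_lines hi'.integral_prod_right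
    (X := (Real.pi ^ 2 / 16 : ℝ) * M), real_smul]
  · push_cast; ring
  · intro ω hω
    have hφ : ContinuousOn (Function.uncurry fun v w => g (spectralPoint ω v w))
        (Metric.sphere 0 1 ×ˢ Metric.sphere 0 1) := by
      refine hg.comp (f := fun p : ℂ × ℂ => spectralPoint ω p.1 p.2)
        (continuous_spectralPoint ω).continuousOn ?_
      rintro ⟨v, w⟩ ⟨hv, hw⟩
      exact spectralPoint_mem_unitarySet hω (by simpa using hv) (by simpa using hw)
    obtain ⟨h1, h2⟩ := integral_slice (M := M) hφ (by
      intro v hv w hw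
      have := hM _ (spectralPoint_mem_unitarySet hω (v := v) (w := w)
        (by simpa using hv) (by simpa using hw))
      simpa only [smul_spectralPoint] using this)
    have e : (fun r : ℝ => r ^ 2 • ∫ x, ((weight (join (x, r • ω)) : ℂ) *
        g (toDisc (point (join (x, r • ω)))))) = fun r : ℝ => (1 / 4 : ℂ) *
          ∫ x, torusIntegrand (fun v w => g (spectralPoint ω v w)) (x + r) (x - r) := by
      ext r
      rw [← integral_smul, ← integral_const_mul]
      congr 1
      ext x
      rw [toDisc_point_join x r hω, weight_join, torusIntegrand, norm_smul, hω, mul_one, real_smul,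
        ← mul_assoc, ← mul_assoc]
      congr 1
      -- For `r < 0` the two factors are merely exchanged.
      have : ((1 + (x + ‖r‖) ^ 2)⁻¹ * (1 + (x - ‖r‖) ^ 2)⁻¹) ^ 2 =
          ((1 + (x + r) ^ 2)⁻¹ * (1 + (x - r) ^ 2)⁻¹) ^ 2 := by
        rw [Real.norm_eq_abs]
        rcases abs_choice r with h | h <;> rw [h]
        ring
      rw [this]
      push_cast
      ring
    rw [e, integral_const_mul, h2]
    refine ⟨h1.const_mul _, ?_⟩
    push_cast; ring

/-! ### Holomorphy and openness -/

section Differentiability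

open scoped Matrix.Norms.Operator

theorem differentiableAt_comp {F : HC → ℂ} {f : HC → HC} {Z : HC}
    (hF : DifferentiableAt ℂ F (f Z)) (hf : DifferentiableAt ℂ f Z) :
    DifferentiableAt ℂ (fun Z => F (f Z)) Z :=
  DifferentiableAt.comp (g := F) Z hF hf

theorem differentiableAt_comp_smul {F : HC → ℂ} {V : HC} {t : ℂ}
    (hF : DifferentiableAt ℂ F (t • V)) : DifferentiableAt ℂ (fun t : ℂ => F (t • V)) t :=
  DifferentiableAt.comp (g := F) t hF (by fun_prop)

theorem differentiableAt_matrix_inv {Z : HC} (h : Z.det ≠ 0) :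
    DifferentiableAt ℂ (fun Z : HC => Z⁻¹) Z := by
  have := differentiableAt_inverse (𝕜 := ℂ) (x := Z)
    ((Matrix.isUnit_iff_isUnit_det _).2 (isUnit_iff_ne_zero.2 h))
  simp only [Matrix.nonsing_inv_eq_ringInverse]
  exact this

theorem differentiableAt_toDisc {Z : HC} (h : (1 - Z).det ≠ 0) : DifferentiableAt ℂ toDisc Z := by
  unfold toDisc
  refine DifferentiableAt.mul (by fun_prop) ?_
  exact DifferentiableAt.comp (g := fun Z : HC => Z⁻¹) Z (differentiableAt_matrix_inv h)
    (by fun_prop)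

theorem differentiableAt_ofDisc {V : HC} (h : (V + 1).det ≠ 0) : DifferentiableAt ℂ ofDisc V := by
  unfold ofDisc
  refine DifferentiableAt.mul (by fun_prop) ?_
  exact DifferentiableAt.comp (g := fun Z : HC => Z⁻¹) V (differentiableAt_matrix_inv h)
    (by fun_prop)

theorem differentiable_N : Differentiable ℂ N := by
  unfold N
  simp only [Matrix.det_fin_two]
  have : ∀ i j, Differentiable ℂ (fun Z : HC => Z i j) := fun i j =>
    (Matrix.entryLinearMap ℂ ℂ i j).toContinuousLinearMap.differentiable
  fun_prop

theorem differentiableAt_affine (A B C Z : HC) :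
    DifferentiableAt ℂ (fun Z : HC => A * Z * B + C) Z := by fun_prop

theorem differentiableAt_add_one (Z : HC) : DifferentiableAt ℂ (fun Z : HC => Z + 1) Z := by
  fun_prop

theorem differentiableAt_one_sub (Z : HC) : DifferentiableAt ℂ (fun Z : HC => 1 - Z) Z := by
  fun_prop

theorem differentiableAt_const_smul {c : ℂ} {f : HC → HC} {Z : HC}
    (hf : DifferentiableAt ℂ f Z) : DifferentiableAt ℂ (fun Z : HC => c • f Z) Z := by
  fun_prop

theorem continuousAt_of_differentiableAt {F : HC → ℂ} {Z : HC} (h : DifferentiableAt ℂ F Z) :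
    ContinuousAt F Z := DifferentiableAt.continuousAt h

theorem continuousAt_of_differentiableAt' {f : HC → HC} {Z : HC} (h : DifferentiableAt ℂ f Z) :
    ContinuousAt f Z := DifferentiableAt.continuousAt h

end Differentiability

theorem isOpen_tubePlus : IsOpen tubePlus := by
  have e : tubePlus = {Z : HC | 0 < (-(Z + Zᴴ)).trace.re} ∩ {Z : HC | 0 < (-(Z + Zᴴ)).det.re} := by
    ext Z
    rw [mem_tubePlus, posDef_iff_trace_det]
    · rfl
    · simp [Matrix.IsHermitian, Matrix.conjTranspose_add, add_comm]
  rw [e]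
  exact (isOpen_lt continuous_const (by fun_prop)).inter (isOpen_lt continuous_const (by fun_prop))

theorem smul_mem_discPlus {V : HC} (h : (1 - V * Vᴴ).PosSemidef) {c : ℂ} (hc : ‖c‖ < 1) :
    c • V ∈ discPlus := by
  have e : 1 - (c • V) * (c • V)ᴴ =
      (1 - ‖c‖ ^ 2 : ℝ) • (1 : HC) + (‖c‖ ^ 2 : ℝ) • (1 - V * Vᴴ) := by
    rw [Matrix.conjTranspose_smul, smul_mul_smul_comm, RCLike.star_def, mul_conj,
      Complex.normSq_eq_norm_sq, Complex.coe_smul]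
    module
  change Matrix.PosDef _
  rw [e]
  have h1 : 0 < 1 - ‖c‖ ^ 2 := by nlinarith [norm_nonneg c]
  exact (Matrix.PosDef.one.smul h1).add_posSemidef (h.smul (by positivity))

theorem posSemidef_of_mem_unitarySet {V : HC} (h : V ∈ unitarySet) :
    (1 - V * Vᴴ).PosSemidef := by
  have h' : V * Vᴴ = 1 := h
  rw [h', sub_self]; exact Matrix.PosSemidef.zero

/-! ### Bounded functions in the Hardy space -/

/-- The function `F` on `𝕋⁺` in the coordinates of the bounded domain `𝔻⁺`. -/
noncomputable def discForm (F : HC → ℂ) (V : HC) : ℂ := F (ofDisc V) / N (V + 1) ^ 2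

/-- Holomorphic functions on `𝕋⁺` with boundary values `Fb` that are bounded in the coordinates of
the bounded domain. -/
structure BoundedHardy (F Fb : HC → ℂ) : Prop where
  diff : DifferentiableOn ℂ F tubePlus
  bdry : ∀ Z ∈ minkowski, Tendsto F (𝓝[tubePlus] Z) (𝓝 (Fb Z))
  bound : ∃ C, ∀ Z ∈ tubePlus, ‖F Z‖ * ‖N (1 - Z)‖ ^ 2 ≤ C

open scoped Matrix.Norms.Operator in
theorem differentiableAt_div_sq {f g : HC → ℂ} {V : HC} (hf : DifferentiableAt ℂ f V)
    (hg : DifferentiableAt ℂ g V) (h : g V ≠ 0) :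
    DifferentiableAt ℂ (fun V => f V / g V ^ 2) V := by
  have h2 : DifferentiableAt ℂ (fun V => g V ^ 2) V := hg.fun_pow 2
  simp only [div_eq_mul_inv]
  exact hf.mul (h2.fun_inv (pow_ne_zero 2 h))

theorem differentiableAt_discForm {F : HC → ℂ} (hF : DifferentiableOn ℂ F tubePlus) {V : HC}
    (hV : V ∈ discPlus) : DifferentiableAt ℂ (discForm F) V := by
  have hd := det_add_one_ne_zero_of_mem_discPlus hV
  have h1 : DifferentiableAt ℂ (fun V => F (ofDisc V)) V :=
    differentiableAt_comp ((hF _ (ofDisc_mem_tubePlus hV)).differentiableAt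
      (isOpen_tubePlus.mem_nhds (ofDisc_mem_tubePlus hV))) (differentiableAt_ofDisc hd)
  have h2 : DifferentiableAt ℂ (fun V => N (V + 1)) V :=
    differentiableAt_comp (differentiable_N _) (differentiableAt_add_one V)
  exact differentiableAt_div_sq h1 h2 hd

theorem N_one_sub_ofDisc {V : HC} (h : (V + 1).det ≠ 0) : N (1 - ofDisc V) = 4 / N (V + 1) := by
  have h1 : (V + 1) * (V + 1)⁻¹ = 1 := Matrix.mul_nonsing_inv _ (isUnit_iff_ne_zero.2 h)
  have e : 1 - ofDisc V = (2 : ℂ) • (V + 1)⁻¹ := by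
    calc 1 - ofDisc V = (V + 1) * (V + 1)⁻¹ - (V - 1) * (V + 1)⁻¹ := by rw [h1, ofDisc]
      _ = (2 : ℂ) • (V + 1)⁻¹ := by rw [two_smul]; noncomm_ring
  rw [e, N, Matrix.det_smul, Fintype.card_fin, Matrix.det_nonsing_inv, Ring.inverse_eq_inv', N]
  norm_num [div_eq_mul_inv]

theorem BoundedHardy.bound_discForm {F Fb : HC → ℂ} (h : BoundedHardy F Fb) :
    ∃ C, ∀ V ∈ discPlus, ‖discForm F V‖ ≤ C := by
  obtain ⟨C, hC⟩ := h.bound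
  refine ⟨C / 16, fun V hV => ?_⟩
  have hd := det_add_one_ne_zero_of_mem_discPlus hV
  have h1 := hC _ (ofDisc_mem_tubePlus hV)
  have hn : 0 < ‖N (V + 1)‖ := norm_pos_iff.2 hd
  rw [N_one_sub_ofDisc hd, norm_div] at h1
  rw [discForm, norm_div, norm_pow, div_le_div_iff₀ (by positivity) (by norm_num)]
  have h4 : ‖(4 : ℂ)‖ = 4 := by norm_num
  rw [h4, div_pow, mul_div_assoc', div_le_iff₀ (by positivity)] at h1
  linarith

theorem star_N (Z : HC) : star (N Z) = N Zᴴ := (Matrix.det_conjTranspose Z).symm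

/-- On `𝕄`, `|N(1 - Z)|⁴ = N(1 - Z)² N(1 + Z)²`. This is what converts the positive weight into the
holomorphic kernel at `-1`. -/
theorem weight_mul (y : Fin 4 → ℝ) :
    (weight y : ℂ) * N (1 - point y) ^ 2 = 1 / N (point y + 1) ^ 2 := by
  have h1 : star (N (1 - point y)) = N (point y + 1) := by
    have : (point y)ᴴ = -point y := point_mem_minkowski y
    rw [star_N, Matrix.conjTranspose_sub, Matrix.conjTranspose_one, this, sub_neg_eq_add, add_comm]
  have h2 := N_one_sub_point_ne_zero y
  have h3 : N (point y + 1) ≠ 0 := by rw [← h1]; exact star_ne_zero.2 h2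
  have h4 : ((‖N (1 - point y)‖ ^ 2 : ℝ) : ℂ) = N (1 - point y) * N (point y + 1) := by
    rw [← h1, RCLike.star_def, mul_conj, Complex.normSq_eq_norm_sq]
  have h5 : (weight y : ℂ) = (((‖N (1 - point y)‖ ^ 2 : ℝ) : ℂ) ^ 2)⁻¹ := by
    rw [weight]; push_cast; ring
  rw [h5, h4]
  field_simp

theorem ofDisc_zero : ofDisc 0 = -1 := by simp [ofDisc]

theorem exists_seq_radius : ∃ ρ : ℕ → ℝ, (∀ n, 0 < ρ n ∧ ρ n < 1) ∧ Tendsto ρ atTop (𝓝 1) := by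
  refine ⟨fun n => 1 - 1 / ((n : ℝ) + 2), fun n => ⟨?_, ?_⟩, ?_⟩
  · rw [sub_pos, div_lt_one (by positivity)]; linarith [(Nat.cast_nonneg n : (0 : ℝ) ≤ n)]
  · have : 0 < 1 / ((n : ℝ) + 2) := by positivity
    linarith
  · have : Tendsto (fun n : ℕ => 1 / ((n : ℝ) + 2)) atTop (𝓝 0) := by
      have := (tendsto_const_div_atTop_nhds_zero_nat (1 : ℝ)).comp (tendsto_add_atTop_nat 2)
      refine this.congr fun n => ?_
      simp
    simpa using tendsto_const_nhds.sub this

theorem tendsto_ofDisc_smul {Z : HC} (hZ : Z ∈ minkowski) {ρ : ℕ → ℝ}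
    (hρ : ∀ n, 0 < ρ n ∧ ρ n < 1) (hlim : Tendsto ρ atTop (𝓝 1)) :
    Tendsto (fun n => (ρ n : ℂ) • toDisc Z) atTop (𝓝 (toDisc Z)) ∧
    (∀ n, (ρ n : ℂ) • toDisc Z ∈ discPlus) ∧
    Tendsto (fun n => ofDisc ((ρ n : ℂ) • toDisc Z)) atTop (𝓝[tubePlus] Z) := by
  have hd := det_one_sub_ne_zero_of_mem_minkowski hZ
  have h1 : Tendsto (fun n => (ρ n : ℂ) • toDisc Z) atTop (𝓝 (toDisc Z)) := by
    have := ((continuous_ofReal.tendsto 1).comp hlim).smul_const (toDisc Z)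
    simpa using this
  have h2 : ∀ n, (ρ n : ℂ) • toDisc Z ∈ discPlus := fun n => by
    refine smul_mem_discPlus (posSemidef_of_mem_unitarySet (toDisc_mul_conjTranspose hZ)) ?_
    rw [norm_real, Real.norm_of_nonneg (hρ n).1.le]; exact (hρ n).2
  refine ⟨h1, h2, tendsto_nhdsWithin_iff.2 ⟨?_, Eventually.of_forall fun n =>
    ofDisc_mem_tubePlus (h2 n)⟩⟩
  have h3 : (toDisc Z + 1).det ≠ 0 := by
    have := det_toDisc_add_one hd
    rw [N] at this
    rw [this]; exact div_ne_zero (by norm_num) hd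
  have h4 := (continuousAt_of_differentiableAt' (differentiableAt_ofDisc h3)).tendsto.comp h1
  rwa [ofDisc_toDisc hd] at h4

/-- The reproducing formula at `-1`. -/
theorem BoundedHardy.integral_at_neg_one {F Fb : HC → ℂ} (h : BoundedHardy F Fb) :
    Integrable (fun y => Fb (point y) / N (point y + 1) ^ 2) ∧
    ∫ y, Fb (point y) / N (point y + 1) ^ 2 = (2 * Real.pi ^ 3 : ℝ) * F (-1) := by
  obtain ⟨ρ, hρ, hlim⟩ := exists_seq_radius
  obtain ⟨C, hC⟩ := h.bound_discForm
  have hmem : ∀ n y, (ρ n : ℂ) • toDisc (point y) ∈ discPlus := fun n y =>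
    (tendsto_ofDisc_smul (point_mem_minkowski y) hρ hlim).2.1 n
  have hP : ∀ n, Integrable (fun y => (weight y : ℂ) *
      discForm F ((ρ n : ℂ) • toDisc (point y))) ∧
      ∫ y, (weight y : ℂ) * discForm F ((ρ n : ℂ) • toDisc (point y)) =
        (Real.pi ^ 3 / 8 : ℝ) * F (-1) := by
    intro n
    have hsm : ∀ V ∈ unitarySet, ∀ t : ℂ, ‖t‖ ≤ 1 → (ρ n : ℂ) • t • V ∈ discPlus := by
      intro V hV t ht
      rw [smul_smul]
      refine smul_mem_discPlus (posSemidef_of_mem_unitarySet hV) ?_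
      rw [norm_mul, norm_real, Real.norm_of_nonneg (hρ n).1.le]
      nlinarith [(hρ n).1, (hρ n).2, norm_nonneg t]
    refine poisson_integral (g := fun V => discForm F ((ρ n : ℂ) • V)) ?_ ?_
    · intro V hV
      have h1 := hsm V hV 1 (by simp)
      rw [one_smul] at h1
      exact (ContinuousAt.comp (f := fun V : HC => (ρ n : ℂ) • V)
        (continuousAt_of_differentiableAt (differentiableAt_discForm h.diff h1))
        (by fun_prop)).continuousWithinAt
    · intro V hV
      have hdiff : DifferentiableOn ℂ (fun t : ℂ => discForm F ((ρ n : ℂ) • t • V))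
          (closure (Metric.ball 0 |1|)) := by
        intro t ht
        have ht' : ‖t‖ ≤ 1 := by
          have := Metric.closure_ball_subset_closedBall ht
          simpa using this
        have h1 := differentiableAt_discForm h.diff (hsm V hV t ht')
        simp only [smul_comm (ρ n : ℂ) _ V] at h1 ⊢
        exact (differentiableAt_comp_smul h1).differentiableWithinAt
      -- The mean value property in `t`: the average is the value at `t = 0`, which is `discForm F 0
      -- = F (-1)`.
      rw [DiffContOnCl.circleAverage hdiff.diffContOnCl]
      simp [discForm, ofDisc_zero, N]
  -- The factor `1/16` comes from `N(V + 1) = 4 / N(1 - Z)`, squared. It turns the constant `π³/8`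
  -- into `2π³` at the end.
  have hpt : ∀ y, Tendsto (fun n => (weight y : ℂ) * discForm F ((ρ n : ℂ) • toDisc (point y)))
      atTop (𝓝 ((1 / 16 : ℂ) * (Fb (point y) / N (point y + 1) ^ 2))) := by
    intro y
    obtain ⟨h1, -, h3⟩ := tendsto_ofDisc_smul (point_mem_minkowski y) hρ hlim
    have hd := N_one_sub_point_ne_zero y
    have h4 : Tendsto (fun n => N ((ρ n : ℂ) • toDisc (point y) + 1)) atTop
        (𝓝 (4 / N (1 - point y))) := by
      rw [← det_toDisc_add_one hd]
      exact (continuous_N.tendsto _).comp (h1.add_const 1)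
    have h5 := (((h.bdry _ (point_mem_minkowski y)).comp h3).div (h4.pow 2)
      (pow_ne_zero 2 (div_ne_zero (by norm_num) hd))).const_mul (weight y : ℂ)
    refine (h5.congr fun n => rfl).trans_eq ?_
    congr 1
    rw [div_eq_mul_one_div (Fb (point y)) (N (point y + 1) ^ 2), ← weight_mul]
    field_simp
    norm_num
  have hb : ∀ n y, ‖(weight y : ℂ) * discForm F ((ρ n : ℂ) • toDisc (point y))‖ ≤
      weight y * C := by
    intro n y
    rw [norm_mul, norm_real, Real.norm_of_nonneg (weight_nonneg y)]
    exact mul_le_mul_of_nonneg_left (hC _ (hmem n y)) (weight_nonneg y)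
  have hmeas := aestronglyMeasurable_of_tendsto_ae atTop
    (fun n => (hP n).1.aestronglyMeasurable) (Eventually.of_forall hpt)
  have hint : Integrable (fun y => (1 / 16 : ℂ) * (Fb (point y) / N (point y + 1) ^ 2)) :=
    (integrable_weight.mul_const C).mono' hmeas (Eventually.of_forall fun y =>
      le_of_tendsto (hpt y).norm (Eventually.of_forall fun n => hb n y))
  have hlimI := tendsto_integral_of_dominated_convergence (fun y => weight y * C)
    (fun n => (hP n).1.aestronglyMeasurable) (integrable_weight.mul_const C)
    (fun n => Eventually.of_forall (hb n)) (Eventually.of_forall hpt)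
  simp only [(hP _).2] at hlimI
  have heq := tendsto_nhds_unique hlimI tendsto_const_nhds
  have h16 : (fun y => Fb (point y) / N (point y + 1) ^ 2) =
      fun y => (16 : ℂ) * ((1 / 16 : ℂ) * (Fb (point y) / N (point y + 1) ^ 2)) := by
    ext y; ring
  rw [h16]
  refine ⟨hint.const_mul _, ?_⟩
  rw [integral_const_mul, heq]
  push_cast; ring

/-! ### Affine automorphisms of the tube domain -/

/-- The affine map `Z ↦ A Z A* + B`. -/
def affine (A B Z : HC) : HC := A * Z * Aᴴ + B

theorem affine_mem_tubePlus {A B Z : HC} (hA : A.det ≠ 0) (hB : B ∈ minkowski)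
    (hZ : Z ∈ tubePlus) : affine A B Z ∈ tubePlus := by
  have hB' : Bᴴ = -B := hB
  rw [mem_tubePlus] at hZ ⊢
  convert posDef_mul_mul_conjTranspose hA hZ using 1
  simp only [affine, Matrix.conjTranspose_add, Matrix.conjTranspose_mul, hB',
    Matrix.conjTranspose_conjTranspose]
  noncomm_ring

theorem affine_mem_minkowski {A B Z : HC} (hB : B ∈ minkowski) (hZ : Z ∈ minkowski) :
    affine A B Z ∈ minkowski := by
  have hB' : Bᴴ = -B := hB
  have hZ' : Zᴴ = -Z := hZ
  change _ᴴ = _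
  simp only [affine, Matrix.conjTranspose_add, Matrix.conjTranspose_mul, hB', hZ',
    Matrix.conjTranspose_conjTranspose]
  noncomm_ring

theorem continuous_affine (A B : HC) : Continuous (affine A B) := by
  unfold affine; fun_prop

/-- For `R = T⁻¹` there is the identity `1 - RR* = (1 - R)(1 - R)* + R(T + T* - 2)R*`, a sum of
positive semidefinite terms. -/
theorem norm_inv_entry_le_one {T : HC} (h : (T + Tᴴ - (2 : ℂ) • (1 : HC)).PosSemidef)
    (hT : T.det ≠ 0) (i j : Fin 2) : ‖T⁻¹ i j‖ ≤ 1 := by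
  set R := T⁻¹ with hR
  have h1 : R * T = 1 := Matrix.nonsing_inv_mul _ (isUnit_iff_ne_zero.2 hT)
  have h2 : Tᴴ * Rᴴ = 1 := by rw [← Matrix.conjTranspose_mul, h1, Matrix.conjTranspose_one]
  have e : 1 - R * Rᴴ = (1 - R) * (1 - R)ᴴ + R * (T + Tᴴ - (2 : ℂ) • (1 : HC)) * Rᴴ := by
    have h3 : R * (T + Tᴴ - (2 : ℂ) • (1 : HC)) * Rᴴ =
        (R * T) * Rᴴ + R * (Tᴴ * Rᴴ) - (2 : ℂ) • (R * Rᴴ) := by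
      simp only [mul_add, mul_sub, add_mul, sub_mul, mul_smul_comm, smul_mul_assoc, mul_one,
        mul_assoc]
    rw [h3, h1, h2, Matrix.conjTranspose_sub, Matrix.conjTranspose_one, two_smul]
    noncomm_ring
  refine norm_entry_le zero_le_one ?_ i j
  have e1 : (((1 ^ 2 : ℝ) : ℂ)) • (1 : HC) - R * Rᴴ = 1 - R * Rᴴ := by simp
  rw [e1, e]
  exact (Matrix.posSemidef_self_mul_conjTranspose _).add (h.mul_mul_conjTranspose_same R)

/-- With `T = 1 - affine A B Z` one has `A(1 - Z)A* = T(T⁻¹K + 1)`, where `K` is constant and the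
entries of `T⁻¹` are bounded by `1`; taking determinants gives the estimate. It shows that
boundedness in disc coordinates survives affine changes of variable. -/
theorem exists_norm_N_one_sub_le {A B : HC} (hA : A.det ≠ 0) (hB : B ∈ minkowski) :
    ∃ C, ∀ Z ∈ tubePlus, ‖N (1 - Z)‖ ≤ C * ‖N (1 - affine A B Z)‖ := by
  set K : HC := A * Aᴴ - 1 + B with hK
  have hcont : Continuous fun R : HC => N (R * K + 1) := by
    unfold N; fun_prop
  obtain ⟨C, hC⟩ := (isCompact_norm_entries_le 1).exists_bound_of_continuousOn hcont.continuousOn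
  refine ⟨C / ‖A.det‖ ^ 2, fun Z hZ => ?_⟩
  set T := 1 - affine A B Z with hT
  have hm := affine_mem_tubePlus hA hB hZ
  have hd : T.det ≠ 0 := det_one_sub_ne_zero_of_mem_tubePlus hm
  have h1 : ∀ i j, ‖T⁻¹ i j‖ ≤ 1 := by
    refine norm_inv_entry_le_one ?_ hd
    convert (mem_tubePlus.1 hm).posSemidef using 1
    rw [hT, Matrix.conjTranspose_sub, Matrix.conjTranspose_one, two_smul]
    abel
  have h2 : T * T⁻¹ = 1 := Matrix.mul_nonsing_inv _ (isUnit_iff_ne_zero.2 hd)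
  have e : A * (1 - Z) * Aᴴ = T * (T⁻¹ * K + 1) := by
    rw [mul_add, ← mul_assoc, h2, hT, hK, affine]
    noncomm_ring
  have e2 := congrArg (fun X : HC => ‖X.det‖) e
  simp only [Matrix.det_mul, Matrix.det_conjTranspose, norm_mul, norm_star] at e2
  have h3 := hC T⁻¹ h1
  have hA' : 0 < ‖A.det‖ := norm_pos_iff.2 hA
  rw [div_mul_eq_mul_div, le_div_iff₀ (by positivity)]
  simp only [N] at h3 ⊢
  calc ‖(1 - Z).det‖ * ‖A.det‖ ^ 2 = ‖A.det‖ * ‖(1 - Z).det‖ * ‖A.det‖ := by ring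
    _ = ‖T.det‖ * ‖(T⁻¹ * K + 1).det‖ := e2
    _ ≤ ‖T.det‖ * C := by gcongr
    _ = C * ‖T.det‖ := mul_comm _ _

theorem BoundedHardy.comp_affine {F Fb : HC → ℂ} (h : BoundedHardy F Fb) {A B : HC}
    (hA : A.det ≠ 0) (hB : B ∈ minkowski) :
    BoundedHardy (fun Z => F (affine A B Z)) (fun Z => Fb (affine A B Z)) where
  diff := fun Z hZ => (differentiableAt_comp (f := affine A B)
    ((h.diff _ (affine_mem_tubePlus hA hB hZ)).differentiableAt
      (isOpen_tubePlus.mem_nhds (affine_mem_tubePlus hA hB hZ)))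
    (differentiableAt_affine A Aᴴ B Z)).differentiableWithinAt
  bdry := fun Z hZ => (h.bdry _ (affine_mem_minkowski hB hZ)).comp
    (tendsto_nhdsWithin_iff.2 ⟨(continuous_affine A B).continuousAt.tendsto.mono_left
      nhdsWithin_le_nhds, eventually_nhdsWithin_of_forall fun Z hZ =>
      affine_mem_tubePlus hA hB hZ⟩)
  bound := by
    obtain ⟨C, hC⟩ := h.bound
    obtain ⟨C', hC'⟩ := exists_norm_N_one_sub_le hA hB
    refine ⟨C' ^ 2 * C, fun Z hZ => ?_⟩
    have h1 := hC _ (affine_mem_tubePlus hA hB hZ)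
    calc ‖F (affine A B Z)‖ * ‖N (1 - Z)‖ ^ 2
        ≤ ‖F (affine A B Z)‖ * (C' * ‖N (1 - affine A B Z)‖) ^ 2 := by
          gcongr; exact hC' Z hZ
      _ = C' ^ 2 * (‖F (affine A B Z)‖ * ‖N (1 - affine A B Z)‖ ^ 2) := by ring
      _ ≤ C' ^ 2 * C := by gcongr

/-! ### The change of variables -/

/-- The lower triangular matrix with diagonal `p`, `s` and off-diagonal entry `q + i q'`. -/
noncomputable def lowerTri (p s q q' : ℝ) : HC := !![(p : ℂ), 0; q + I * q', (s : ℂ)]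

/-- The matrix of `Z ↦ A Z A*` on Minkowski space, for `A` lower triangular. -/
noncomputable def lowerTriAction (p s q q' : ℝ) : Matrix (Fin 4) (Fin 4) ℝ :=
  !![(p ^ 2 + (q ^ 2 + q' ^ 2) + s ^ 2) / 2, s * q, s * q', (p ^ 2 + (q ^ 2 + q' ^ 2) - s ^ 2) / 2;
    p * q, p * s, 0, p * q;
    p * q', 0, p * s, p * q';
    (p ^ 2 - (q ^ 2 + q' ^ 2) - s ^ 2) / 2, -(s * q), -(s * q'),
      (p ^ 2 - (q ^ 2 + q' ^ 2) + s ^ 2) / 2]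

theorem det_lowerTriAction (p s q q' : ℝ) : (lowerTriAction p s q q').det = (p * s) ^ 4 := by
  simp [lowerTriAction, Matrix.det_succ_row_zero, Fin.sum_univ_succ, Fin.succAbove]
  ring

theorem det_lowerTri (p s q q' : ℝ) : (lowerTri p s q q').det = ((p * s : ℝ) : ℂ) := by
  simp [lowerTri, Matrix.det_fin_two]

theorem point_lowerTriAction (p s q q' : ℝ) (y : Fin 4 → ℝ) :
    point ((lowerTriAction p s q q').mulVec y) =
      lowerTri p s q q' * point y * (lowerTri p s q q')ᴴ := by
  ext i j
  fin_cases i <;> fin_cases j <;> apply Complex.ext <;>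
    simp [point, basis, lowerTri, lowerTriAction, Fin.sum_univ_four, Matrix.mulVec, dotProduct,
      Matrix.mul_apply, Fin.sum_univ_two, Matrix.conjTranspose_apply, sq] <;> ring

theorem lowerTri_mul_conjTranspose (p s q q' : ℝ) :
    lowerTri p s q q' * (lowerTri p s q q')ᴴ =
      !![((p ^ 2 : ℝ) : ℂ), (p * q : ℝ) - I * (p * q' : ℝ);
        (p * q : ℝ) + I * (p * q' : ℝ), (q ^ 2 + q' ^ 2 + s ^ 2 : ℝ)] := by
  ext i j
  fin_cases i <;> fin_cases j <;> apply Complex.ext <;>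
    simp [lowerTri, Matrix.vecMul, dotProduct, Fin.sum_univ_two, Matrix.conjTranspose_apply,
      sq] <;> ring

theorem point_add (y y' : Fin 4 → ℝ) : point (y + y') = point y + point y' := by
  simp [point, add_smul, Finset.sum_add_distrib]

theorem integral_comp_mulVec_add {M : Matrix (Fin 4) (Fin 4) ℝ} (hM : M.det ≠ 0) (b : Fin 4 → ℝ)
    (f : (Fin 4 → ℝ) → ℂ) :
    (Integrable (fun y => f (M.mulVec y + b)) ↔ Integrable f) ∧
    ∫ y, f (M.mulVec y + b) = (|M.det|⁻¹ : ℝ) * ∫ y, f y := by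
  have h1 := Real.map_matrix_volume_pi_eq_smul_volume_pi hM
  have hemb : MeasurableEmbedding (Matrix.toLin' M) := by
    have hinj : Function.Injective (Matrix.toLin' M) := by
      rw [Matrix.toLin'_apply']
      exact Matrix.mulVec_injective_iff_isUnit.2
        ((Matrix.isUnit_iff_isUnit_det _).2 (isUnit_iff_ne_zero.2 hM))
    exact (LinearMap.continuous_of_finiteDimensional _).measurableEmbedding hinj
  have hne : ENNReal.ofReal |M.det⁻¹| ≠ 0 := by
    simp [hM]
  constructor
  · have h2 := hemb.integrable_map_iff (μ := volume) (g := fun y => f (y + b))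
    rw [h1, integrable_smul_measure hne ENNReal.ofReal_ne_top] at h2
    have h3 : Integrable (fun y => f (y + b)) ↔ Integrable f :=
      (measurePreserving_add_right volume b).integrable_comp_emb
        (measurableEmbedding_addRight b) (g := f)
    rw [← h3, h2]; rfl
  · have h2 := hemb.integral_map (μ := volume) (fun y => f (y + b))
    rw [h1, integral_smul_measure, integral_add_right_eq_self,
      ENNReal.toReal_ofReal (abs_nonneg _), abs_inv, real_smul] at h2
    rw [h2]; rfl

/-- Cholesky factorization: `-(W + W*)/2 = AA*` with `A` lower triangular and positive diagonal.
Then `W + AA*` is the skew-Hermitian part of `W`. -/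
theorem exists_eq_affine_neg_one {W : HC} (hW : W ∈ tubePlus) :
    ∃ p s q q' : ℝ, 0 < p ∧ 0 < s ∧ ∃ B ∈ minkowski, affine (lowerTri p s q q') B (-1) = W := by
  have hP := mem_tubePlus.1 hW
  obtain ⟨ht, hd⟩ := (posDef_iff_trace_det hP.1).1 hP
  have h00 : 0 < (-(W + Wᴴ)) 0 0 := hP.diag_pos
  have h00' := (Complex.lt_def.1 h00).1
  simp only [Matrix.neg_apply, Matrix.add_apply, Matrix.conjTranspose_apply, RCLike.star_def,
    neg_re, add_re, conj_re, zero_re] at h00'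
  simp only [Matrix.det_fin_two, Matrix.neg_apply, Matrix.add_apply, Matrix.conjTranspose_apply,
    RCLike.star_def, neg_re, add_re, conj_re, sub_re, mul_re, neg_im, add_im, conj_im] at hd
  set a := -(W 0 0).re with ha
  set d := -(W 1 1).re with hd'
  set c := -((W 1 0).re + (W 0 1).re) / 2 with hc
  set c' := -((W 1 0).im - (W 0 1).im) / 2 with hc'
  have ha0 : 0 < a := by linarith
  have hdet : 0 < d - (c ^ 2 + c' ^ 2) / a := by
    rw [sub_pos, div_lt_iff₀ ha0]
    rw [hc, hc', ha, hd']
    nlinarith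
  have hp : 0 < √a := Real.sqrt_pos.2 ha0
  have hp2 : √a ^ 2 = a := Real.sq_sqrt ha0.le
  set p := √a
  have hs : 0 < √(d - (c ^ 2 + c' ^ 2) / a) := Real.sqrt_pos.2 hdet
  have hs2 : √(d - (c ^ 2 + c' ^ 2) / a) ^ 2 = d - (c ^ 2 + c' ^ 2) / a := Real.sq_sqrt hdet.le
  set s := √(d - (c ^ 2 + c' ^ 2) / a)
  refine ⟨p, s, c / p, c' / p, hp, hs, W + lowerTri p s (c / p) (c' / p) *
    (lowerTri p s (c / p) (c' / p))ᴴ, ?_, ?_⟩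
  · have e1 : p * (c / p) = c := by field_simp
    have e2 : p * (c' / p) = c' := by field_simp
    have e3 : (c / p) ^ 2 + (c' / p) ^ 2 + s ^ 2 = d := by
      rw [hs2, ← hp2]; field_simp; ring
    change _ᴴ = _
    rw [lowerTri_mul_conjTranspose, e1, e2, e3, hp2]
    ext i j
    fin_cases i <;> fin_cases j <;> apply Complex.ext <;>
      simp [Matrix.conjTranspose_apply] <;> linarith
  · simp [affine]

/-- The reproducing formula for bounded functions. -/
theorem BoundedHardy.integral_eq {F Fb : HC → ℂ} (h : BoundedHardy F Fb) {W : HC}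
    (hW : W ∈ tubePlus) :
    Integrable (fun y => Fb (point y) / N (point y - W) ^ 2) ∧
    ∫ y, Fb (point y) / N (point y - W) ^ 2 = (2 * Real.pi ^ 3 : ℝ) * F W := by
  obtain ⟨p, s, q, q', hp, hs, B, hB, rfl⟩ := exists_eq_affine_neg_one hW
  set A := lowerTri p s q q' with hA
  have hps : 0 < p * s := mul_pos hp hs
  have hAd : A.det = ((p * s : ℝ) : ℂ) := det_lowerTri p s q q'
  have hA0 : A.det ≠ 0 := by rw [hAd]; exact_mod_cast hps.ne'
  obtain ⟨b, hb⟩ : ∃ b, point b = B := by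
    rw [← range_point] at hB; exact hB
  obtain ⟨h1, h2⟩ := (h.comp_affine hA0 hB).integral_at_neg_one
  have hM : (lowerTriAction p s q q').det ≠ 0 := by
    rw [det_lowerTriAction]; positivity
  obtain ⟨h3, h4⟩ := integral_comp_mulVec_add hM b
    (fun y => Fb (point y) / N (point y - affine A B (-1)) ^ 2)
  have e1 : ∀ y, point ((lowerTriAction p s q q').mulVec y + b) = affine A B (point y) := fun y => by
    rw [point_add, point_lowerTriAction, hb, affine]
  have e2 : ∀ y, N (affine A B (point y) - affine A B (-1)) =
      ((p * s : ℝ) : ℂ) ^ 2 * N (point y + 1) := fun y => by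
    have : affine A B (point y) - affine A B (-1) = A * (point y + 1) * Aᴴ := by
      simp only [affine]; noncomm_ring
    rw [this, N, Matrix.det_mul, Matrix.det_mul, Matrix.det_conjTranspose, hAd, N]
    simp only [RCLike.star_def, conj_ofReal]
    ring
  have hc : ((p * s : ℝ) : ℂ) ≠ 0 := by exact_mod_cast hps.ne'
  have e3 : ∀ y, Fb (affine A B (point y)) / (((p * s : ℝ) : ℂ) ^ 2 * N (point y + 1)) ^ 2 =
      (((p * s : ℝ) : ℂ) ^ 4)⁻¹ * (Fb (affine A B (point y)) / N (point y + 1) ^ 2) := fun y => by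
    rw [mul_pow, ← pow_mul, div_mul_eq_div_div_swap, div_eq_inv_mul]
  simp only [e1, e2, e3] at h3 h4
  refine ⟨h3.1 (h1.const_mul _), ?_⟩
  rw [integral_const_mul, h2, det_lowerTriAction, abs_of_pos (by positivity)] at h4
  -- The Jacobian `(ps)⁴` equals `|det A|⁴`, the factor by which the squared kernel scales, so the
  -- two cancel.
  have h5 : (((((p * s) ^ 4)⁻¹ : ℝ)) : ℂ) = (((p * s : ℝ) : ℂ) ^ 4)⁻¹ := by push_cast; rfl
  rw [h5] at h4
  exact (mul_left_cancel₀ (inv_ne_zero (pow_ne_zero 4 hc)) h4).symm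

/-! ### Functions that extend continuously to a neighborhood of `U(2)` -/

theorem eq_discForm {F : HC → ℂ} {Z : HC} (hZ : Z ∈ tubePlus) :
    F Z = 16 * discForm F (toDisc Z) / N (1 - Z) ^ 2 := by
  have hd := det_one_sub_ne_zero_of_mem_tubePlus hZ
  have hd' : N (1 - Z) ≠ 0 := hd
  rw [discForm, ofDisc_toDisc hd, det_toDisc_add_one hd]
  field_simp
  norm_num

theorem isCompact_closedDisc : IsCompact {V : HC | (1 - V * Vᴴ).PosSemidef} := by
  refine (isCompact_norm_entries_le 1).of_isClosed_subset ?_ fun V hV i j => ?_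
  · have e : {V : HC | (1 - V * Vᴴ).PosSemidef} =
        ⋂ x : Fin 2 → ℂ, {V : HC | 0 ≤ star x ⬝ᵥ ((1 - V * Vᴴ) *ᵥ x)} := by
      ext V
      rw [Set.mem_iInter]
      change Matrix.PosSemidef _ ↔ _
      rw [Matrix.posSemidef_iff_dotProduct_mulVec]
      exact ⟨fun h => h.2, fun h => ⟨by simp [Matrix.IsHermitian], h⟩⟩
    rw [e]
    refine isClosed_iInter fun x => isClosed_le continuous_const ?_
    simp only [dotProduct, Matrix.mulVec]
    fun_prop
  · refine norm_entry_le zero_le_one ?_ i j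
    have e1 : (((1 ^ 2 : ℝ) : ℂ)) • (1 : HC) - V * Vᴴ = 1 - V * Vᴴ := by simp
    rw [e1]; exact hV

theorem differentiableAt_dilate {F : HC → ℂ} (hF : DifferentiableOn ℂ F tubePlus) {r : ℝ} {Z : HC}
    (hd : (1 - Z).det ≠ 0) (hr : (r : ℂ) • toDisc Z ∈ discPlus) :
    DifferentiableAt ℂ (fun Z => discForm F ((r : ℂ) • toDisc Z) / N (1 - Z) ^ 2) Z := by
  refine differentiableAt_div_sq (g := fun Z => N (1 - Z)) ?_ ?_ hd
  · exact differentiableAt_comp (f := fun Z => (r : ℂ) • toDisc Z) (differentiableAt_discForm hF hr)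
      (differentiableAt_const_smul (differentiableAt_toDisc hd))
  · exact differentiableAt_comp (differentiable_N _) (differentiableAt_one_sub Z)

/-- Multiplication by `r < 1` sends the closed disc into the open one. Compactness then gives the
bound and continuity the boundary values, whatever `F` does at the boundary. -/
theorem boundedHardy_dilate {F : HC → ℂ} (hF : DifferentiableOn ℂ F tubePlus) {r : ℝ}
    (hr0 : 0 < r) (hr1 : r < 1) :
    BoundedHardy (fun Z => discForm F ((r : ℂ) • toDisc Z) / N (1 - Z) ^ 2)
      (fun Z => discForm F ((r : ℂ) • toDisc Z) / N (1 - Z) ^ 2) := by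
  have hn : ‖(r : ℂ)‖ < 1 := by rwa [norm_real, Real.norm_of_nonneg hr0.le]
  refine ⟨fun Z hZ => ?_, fun Z hZ => ?_, ?_⟩
  · exact (differentiableAt_dilate hF (det_one_sub_ne_zero_of_mem_tubePlus hZ)
      (smul_mem_discPlus (Matrix.PosDef.posSemidef (toDisc_mem_discPlus hZ))
        hn)).differentiableWithinAt
  · exact (continuousAt_of_differentiableAt (differentiableAt_dilate hF
      (det_one_sub_ne_zero_of_mem_minkowski hZ) (smul_mem_discPlus
        (posSemidef_of_mem_unitarySet (toDisc_mul_conjTranspose hZ)) hn))).tendsto.mono_left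
          nhdsWithin_le_nhds
  · have hc : ContinuousOn (fun V => discForm F ((r : ℂ) • V))
        {V : HC | (1 - V * Vᴴ).PosSemidef} := fun V hV =>
      (ContinuousAt.comp (f := fun V : HC => (r : ℂ) • V) (continuousAt_of_differentiableAt
        (differentiableAt_discForm hF (smul_mem_discPlus hV hn)))
          (by fun_prop)).continuousWithinAt
    obtain ⟨C, hC⟩ := isCompact_closedDisc.exists_bound_of_continuousOn hc
    refine ⟨C, fun Z hZ => ?_⟩
    have h1 : 0 < ‖N (1 - Z)‖ := norm_pos_iff.2 (det_one_sub_ne_zero_of_mem_tubePlus hZ)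
    rw [norm_div, norm_pow, div_mul_cancel₀ _ (by positivity)]
    exact hC _ (Matrix.PosDef.posSemidef (toDisc_mem_discPlus hZ))

/-- This supplies the dominating function for the dilation limit. It is the integrability half of
the bounded formula, applied to the function whose disc form is constant. -/
theorem integrable_inv_N_sq {W : HC} (hW : W ∈ tubePlus) :
    Integrable (fun y => ‖1 / N (1 - point y) ^ 2 / N (point y - W) ^ 2‖) := by
  have hd : ∀ Z : HC, (1 - Z).det ≠ 0 → DifferentiableAt ℂ (fun Z => (1 : ℂ) / N (1 - Z) ^ 2) Z :=
    fun Z hZ => differentiableAt_div_sq (f := fun _ => 1) (g := fun Z => N (1 - Z))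
      (differentiableAt_comp (F := fun _ => 1) (f := id) (differentiableAt_const _)
        differentiableAt_id)
      (differentiableAt_comp (differentiable_N _) (differentiableAt_one_sub Z)) hZ
  have h : BoundedHardy (fun Z => (1 : ℂ) / N (1 - Z) ^ 2) (fun Z => (1 : ℂ) / N (1 - Z) ^ 2) := by
    refine ⟨fun Z hZ => (hd Z (det_one_sub_ne_zero_of_mem_tubePlus hZ)).differentiableWithinAt,
      fun Z hZ => (continuousAt_of_differentiableAt (hd Z
        (det_one_sub_ne_zero_of_mem_minkowski hZ))).tendsto.mono_left nhdsWithin_le_nhds,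
      1, fun Z hZ => ?_⟩
    have h1 : 0 < ‖N (1 - Z)‖ := norm_pos_iff.2 (det_one_sub_ne_zero_of_mem_tubePlus hZ)
    rw [norm_div, norm_pow, div_mul_cancel₀ _ (by positivity), norm_one]
  exact (h.integral_eq hW).1.norm

/-- The reproducing formula for a function on `𝕋⁺` that extends continuously to a neighborhood of
`U(2)` in the coordinates of the bounded domain. -/
theorem reproducing_formula {F G : HC → ℂ} (hF : DifferentiableOn ℂ F tubePlus) {O : Set HC}
    (hO : IsOpen O) (hUO : unitarySet ⊆ O) (hG : ContinuousOn G O)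
    (hGF : ∀ V ∈ discPlus, V ∈ O → discForm F V = G V) :
    (∀ Z ∈ minkowski, Tendsto F (𝓝[tubePlus] Z) (𝓝 (16 * G (toDisc Z) / N (1 - Z) ^ 2))) ∧
    ∀ W ∈ tubePlus,
      Integrable (fun y => 16 * G (toDisc (point y)) / N (1 - point y) ^ 2 /
        N (point y - W) ^ 2) ∧
      ∫ y, 16 * G (toDisc (point y)) / N (1 - point y) ^ 2 / N (point y - W) ^ 2 =
        (2 * Real.pi ^ 3 : ℝ) * F W := by
  have hGc : ∀ V ∈ unitarySet, ContinuousAt G V := fun V hV =>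
    hG.continuousAt (hO.mem_nhds (hUO hV))
  refine ⟨fun Z hZ => ?_, fun W hW => ?_⟩
  · have hd := det_one_sub_ne_zero_of_mem_minkowski hZ
    have hU : toDisc Z ∈ unitarySet := toDisc_mul_conjTranspose hZ
    have h1 : ContinuousAt toDisc Z :=
      continuousAt_of_differentiableAt' (differentiableAt_toDisc hd)
    have h2 : ContinuousAt (fun Z => 16 * G (toDisc Z) / N (1 - Z) ^ 2) Z := by
      refine ContinuousAt.div (continuousAt_const.mul
        (ContinuousAt.comp (f := toDisc) (hGc _ hU) h1)) ?_ (pow_ne_zero 2 hd)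
      exact ((continuous_N.comp (continuous_const.sub continuous_id)).pow 2).continuousAt
    refine (h2.tendsto.mono_left nhdsWithin_le_nhds).congr' ?_
    have h3 : ∀ᶠ Z' in 𝓝[tubePlus] Z, toDisc Z' ∈ O :=
      nhdsWithin_le_nhds (h1.eventually (hO.mem_nhds (hUO hU)))
    filter_upwards [h3, self_mem_nhdsWithin] with Z' hZ' hT
    rw [eq_discForm (F := F) hT, hGF _ (toDisc_mem_discPlus hT) hZ']
  · obtain ⟨ρ, hρ, hlim⟩ := exists_seq_radius
    obtain ⟨C, hC⟩ := isCompact_unitarySet.exists_bound_of_continuousOn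
      (hG.mono hUO)
    have hn : ∀ n, ‖(ρ n : ℂ)‖ < 1 := fun n => by
      rw [norm_real, Real.norm_of_nonneg (hρ n).1.le]; exact (hρ n).2
    have hlimC : Tendsto (fun n => (ρ n : ℂ)) atTop (𝓝 1) := by
      simpa [Function.comp_def] using (continuous_ofReal.tendsto 1).comp hlim
    -- Compactness of `U(2)` makes the neighborhood of `t = 1` uniform in `V`: all `tV` stay in `O`,
    -- with `G` bounded by `C + 1` there.
    have hev : ∀ᶠ t in 𝓝 (1 : ℂ), ∀ V ∈ unitarySet, t • V ∈ O ∧ ‖G (t • V)‖ < C + 1 := by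
      refine isCompact_unitarySet.eventually_forall_of_forall_eventually fun V hV => ?_
      have hc : ContinuousAt (fun p : ℂ × HC => p.1 • p.2) (1, V) := by fun_prop
      have hc' : Tendsto (fun p : ℂ × HC => p.1 • p.2) (𝓝 (1, V)) (𝓝 V) := by
        simpa [ContinuousAt] using hc
      refine (hc'.eventually (hO.mem_nhds (hUO hV))).and ?_
      have h1 : ∀ᶠ V' in 𝓝 V, ‖G V'‖ < C + 1 :=
        (hGc V hV).norm.eventually (gt_mem_nhds (by linarith [hC V hV]))
      exact hc'.eventually h1
    have hevn : ∀ᶠ n in atTop, ∀ V ∈ unitarySet,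
        ‖discForm F ((ρ n : ℂ) • V)‖ ≤ C + 1 ∧
          discForm F ((ρ n : ℂ) • V) = G ((ρ n : ℂ) • V) := by
      filter_upwards [hlimC.eventually hev] with n hn' V hV
      have h1 := hGF _ (smul_mem_discPlus (posSemidef_of_mem_unitarySet hV) (hn n)) (hn' V hV).1
      exact ⟨by rw [h1]; exact (hn' V hV).2.le, h1⟩
    set f : ℕ → (Fin 4 → ℝ) → ℂ := fun n y =>
      discForm F ((ρ n : ℂ) • toDisc (point y)) / N (1 - point y) ^ 2 / N (point y - W) ^ 2 with hf
    -- The bounded formula applies to each dilate; the rest of the argument passes to the limit on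
    -- both sides.
    have hfi : ∀ n, Integrable (f n) ∧ ∫ y, f n y = (2 * Real.pi ^ 3 : ℝ) *
        (discForm F ((ρ n : ℂ) • toDisc W) / N (1 - W) ^ 2) := fun n =>
      (boundedHardy_dilate hF (hρ n).1 (hρ n).2).integral_eq hW
    have hbd : Integrable (fun y =>
        (C + 1) * ‖1 / N (1 - point y) ^ 2 / N (point y - W) ^ 2‖) :=
      (integrable_inv_N_sq hW).const_mul _
    have hb : ∀ᶠ n in atTop, ∀ y, ‖f n y‖ ≤
        (C + 1) * ‖1 / N (1 - point y) ^ 2 / N (point y - W) ^ 2‖ := by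
      filter_upwards [hevn] with n hn' y
      have h1 := (hn' _ (toDisc_point_mem_unitarySet y)).1
      have h2 : f n y = discForm F ((ρ n : ℂ) • toDisc (point y)) *
          (1 / N (1 - point y) ^ 2 / N (point y - W) ^ 2) := by simp only [hf]; ring
      rw [h2, norm_mul]
      gcongr
    have hpt : ∀ y, Tendsto (fun n => f n y) atTop
        (𝓝 (G (toDisc (point y)) / N (1 - point y) ^ 2 / N (point y - W) ^ 2)) := by
      intro y
      have hU := toDisc_point_mem_unitarySet y
      have h1 := (tendsto_ofDisc_smul (point_mem_minkowski y) hρ hlim).1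
      have h2 : Tendsto (fun n => discForm F ((ρ n : ℂ) • toDisc (point y))) atTop
          (𝓝 (G (toDisc (point y)))) := by
        refine ((hGc _ hU).tendsto.comp h1).congr' ?_
        filter_upwards [hevn] with n hn'
        exact ((hn' _ hU).2).symm
      exact (h2.div_const _).div_const _
    have hmeas := aestronglyMeasurable_of_tendsto_ae atTop
      (fun n => (hfi n).1.aestronglyMeasurable) (Eventually.of_forall hpt)
    have hint : Integrable (fun y =>
        G (toDisc (point y)) / N (1 - point y) ^ 2 / N (point y - W) ^ 2) :=
      hbd.mono' hmeas (Eventually.of_forall fun y => le_of_tendsto (hpt y).norm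
        (hb.mono fun n hn' => hn' y))
    have hI := tendsto_integral_filter_of_dominated_convergence _
      (Eventually.of_forall fun n => (hfi n).1.aestronglyMeasurable)
      (hb.mono fun n hn' => Eventually.of_forall hn') hbd (Eventually.of_forall hpt)
    have hV := toDisc_mem_discPlus hW
    have hW1 : Tendsto (fun n => (ρ n : ℂ) • toDisc W) atTop (𝓝 (toDisc W)) := by
      simpa using hlimC.smul_const (toDisc W)
    have hI' : Tendsto (fun n => ∫ y, f n y) atTop (𝓝 ((2 * Real.pi ^ 3 : ℝ) *
        (discForm F (toDisc W) / N (1 - W) ^ 2))) := by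
      simp only [(hfi _).2]
      exact (((continuousAt_of_differentiableAt (differentiableAt_discForm hF hV)).tendsto.comp
        hW1).div_const _).const_mul _
    have heq := tendsto_nhds_unique hI hI'
    have e16 : (fun y => 16 * G (toDisc (point y)) / N (1 - point y) ^ 2 /
        N (point y - W) ^ 2) = fun y => 16 *
          (G (toDisc (point y)) / N (1 - point y) ^ 2 / N (point y - W) ^ 2) := by
      ext y; ring
    rw [e16]
    refine ⟨hint.const_mul _, ?_⟩
    rw [integral_const_mul, heq, eq_discForm (F := F) hW]
    ring

/-! ### The function spaces -/

theorem minkowski_subset_closure_tubePlus : minkowski ⊆ closure tubePlus := by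
  intro Z hZ
  obtain ⟨ρ, hρ, hlim⟩ := exists_seq_radius
  obtain ⟨-, h2, h3⟩ := tendsto_ofDisc_smul hZ hρ hlim
  exact mem_closure_of_tendsto (h3.mono_right nhdsWithin_le_nhds)
    (Eventually.of_forall fun n => ofDisc_mem_tubePlus (h2 n))

theorem minkowski_subset_closure_tubeMinus : minkowski ⊆ closure tubeMinus := by
  intro Z hZ
  have h := minkowski_subset_closure_tubePlus (neg_mem_minkowski.2 hZ)
  have e : tubeMinus = Neg.neg ⁻¹' tubePlus := Set.ext fun Z => mem_tubeMinus
  have h2 : -(-Z) ∈ closure (Neg.neg '' tubePlus) :=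
    image_closure_subset_closure_image continuous_neg ⟨-Z, h, rfl⟩
  rwa [neg_neg, Set.image_neg_eq_neg, ← Set.neg_preimage, ← e] at h2

theorem smul_mem_unitarySet {c : ℂ} (hc : ‖c‖ = 1) {V : HC} (hV : V ∈ unitarySet) :
    c • V ∈ unitarySet := by
  have hV' : V * Vᴴ = 1 := hV
  change _ * _ = _
  rw [Matrix.conjTranspose_smul, smul_mul_smul_comm, hV', RCLike.star_def, mul_conj,
    Complex.normSq_eq_norm_sq, hc]
  simp

theorem unitarySet_subset_closure_discPlus : unitarySet ⊆ closure discPlus := by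
  intro V hV
  obtain ⟨ρ, hρ, hlim⟩ := exists_seq_radius
  refine mem_closure_of_tendsto (f := fun n => (ρ n : ℂ) • V) (b := atTop) ?_
    (Eventually.of_forall fun n =>
    smul_mem_discPlus (posSemidef_of_mem_unitarySet hV) ?_)
  · simpa using ((continuous_ofReal.tendsto 1).comp hlim).smul_const V
  · rw [norm_real, Real.norm_of_nonneg (hρ n).1.le]; exact (hρ n).2

theorem unitarySet_subset_closure_discMinus : unitarySet ⊆ closure discMinus := by
  intro V hV
  obtain ⟨ρ, hρ, hlim⟩ := exists_seq_radius
  have hV' : V * Vᴴ = 1 := hV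
  refine mem_closure_of_tendsto (f := fun n => ((ρ n : ℂ))⁻¹ • V) (b := atTop) ?_
    (Eventually.of_forall fun n => ?_)
  · simpa using (((continuous_ofReal.tendsto 1).comp hlim).inv₀ (by simp)).smul_const V
  · have h1 : 1 < (ρ n)⁻¹ ^ 2 := one_lt_pow₀ ((one_lt_inv₀ (hρ n).1).2 (hρ n).2) two_ne_zero
    have e : ((ρ n : ℂ)⁻¹ • V) * ((ρ n : ℂ)⁻¹ • V)ᴴ - 1 = ((ρ n)⁻¹ ^ 2 - 1 : ℝ) • (1 : HC) := by
      rw [Matrix.conjTranspose_smul, smul_mul_smul_comm, hV', RCLike.star_def, ← ofReal_inv,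
        conj_ofReal, ← ofReal_mul, Complex.coe_smul]
      module
    change Matrix.PosDef _
    rw [e]
    exact Matrix.PosDef.one.smul (sub_pos.2 h1)

/-- The disc coordinate used in the proof differs from that of `γ` by the rotation `V ↦ iV`: at `iV`
the map `(Z - i)(Z + i)⁻¹` becomes `(V - 1)(V + 1)⁻¹`. -/
theorem rho1_cayley_inv_eq {F : HC → ℂ} (V : HC) :
    rho1 cayley⁻¹ F (I • V) = -4 * discForm F V := by
  have e1 : I • V - I • (1 : HC) = I • (V - 1) := (smul_sub _ _ _).symm
  have e2 : I • V + I • (1 : HC) = I • (V + 1) := (smul_add _ _ _).symm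
  have e3 : N (I • (V + 1)) = -N (V + 1) := by
    rw [N, Matrix.det_smul, Fintype.card_fin, I_sq, neg_one_mul, N]
  rw [rho1_cayley_inv, e1, e2, e3, discForm, neg_sq, ← mul_div_assoc, ofDisc]
  congr 3
  by_cases h : IsUnit (V + 1).det
  · have e : (I • (V + 1))⁻¹ = (-I) • (V + 1)⁻¹ := by
      apply Matrix.inv_eq_right_inv
      rw [smul_mul_smul_comm, Matrix.mul_nonsing_inv _ h]
      simp
    rw [e, smul_mul_smul_comm]
    simp
  · have h' : ¬ IsUnit (I • (V + 1)).det := by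
      change ¬ IsUnit (N (I • (V + 1)))
      rw [e3, IsUnit.neg_iff]; exact h
    rw [Matrix.nonsing_inv_apply_not_isUnit _ h, Matrix.nonsing_inv_apply_not_isUnit _ h']
    simp

theorem I_smul_mem_discPlus {V : HC} (hV : V ∈ discPlus) : I • V ∈ discPlus := by
  change Matrix.PosDef _
  rw [Matrix.conjTranspose_smul, smul_mul_smul_comm, RCLike.star_def, conj_I, mul_neg, I_mul_I,
    neg_neg, one_smul]
  exact hV

theorem I_smul_inv_mem_discMinus {V : HC} (hV : V ∈ discPlus) (hd : V.det ≠ 0) :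
    I • V⁻¹ ∈ discMinus := by
  have h1 : V⁻¹ * V = 1 := Matrix.nonsing_inv_mul _ (isUnit_iff_ne_zero.2 hd)
  have h2 : Vᴴ * (V⁻¹)ᴴ = 1 := by rw [← Matrix.conjTranspose_mul, h1, Matrix.conjTranspose_one]
  have e : (I • V⁻¹) * (I • V⁻¹)ᴴ - 1 = V⁻¹ * (1 - V * Vᴴ) * (V⁻¹)ᴴ := by
    have h3 : V⁻¹ * (1 - V * Vᴴ) * (V⁻¹)ᴴ = V⁻¹ * (V⁻¹)ᴴ - (V⁻¹ * V) * (Vᴴ * (V⁻¹)ᴴ) := by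
      noncomm_ring
    rw [h3, h1, h2, Matrix.conjTranspose_smul, smul_mul_smul_comm]
    simp
  change Matrix.PosDef _
  rw [e]
  exact posDef_mul_mul_conjTranspose
    (Matrix.isUnit_nonsing_inv_det _ (isUnit_iff_ne_zero.2 hd)).ne_zero hV

theorem continuousOn_matrix_inv : ContinuousOn (fun V : HC => V⁻¹) {V : HC | V.det ≠ 0} :=
  fun _ hV => (continuousAt_of_differentiableAt'
    (differentiableAt_matrix_inv hV)).continuousWithinAt

/-- Reflection of the tube corresponds to inversion of the disc coordinate, `ofDisc V⁻¹ = -ofDisc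
V`, and the denominators differ by `N(V⁻¹ + 1) = N(V)⁻¹ N(V + 1)`. It reduces `𝕋⁻` to `𝕋⁺`. -/
theorem discForm_comp_neg {F : HC → ℂ} {V : HC} (hV : V ∈ discPlus) (hd : V.det ≠ 0) :
    discForm (fun Z => F (-Z)) V = discForm F V⁻¹ / N V ^ 2 := by
  have h1 : V * V⁻¹ = 1 := Matrix.mul_nonsing_inv _ (isUnit_iff_ne_zero.2 hd)
  have h2 : V⁻¹ * V = 1 := Matrix.nonsing_inv_mul _ (isUnit_iff_ne_zero.2 hd)
  have hd1 := det_add_one_ne_zero_of_mem_discPlus hV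
  have h3 : (V + 1) * (V + 1)⁻¹ = 1 := Matrix.mul_nonsing_inv _ (isUnit_iff_ne_zero.2 hd1)
  have e1 : V⁻¹ + 1 = V⁻¹ * (V + 1) := by rw [mul_add, h2, mul_one, add_comm]
  have e2 : (V⁻¹ + 1)⁻¹ = (V + 1)⁻¹ * V := by
    apply Matrix.inv_eq_right_inv
    rw [e1, mul_assoc, ← mul_assoc (V + 1), h3, one_mul, h2]
  have e3 : ofDisc V⁻¹ = -ofDisc V := by
    have h5 : (V + 1)⁻¹ * V = V * (V + 1)⁻¹ := by
      have h6 : (V + 1)⁻¹ * (V + 1) = 1 := Matrix.nonsing_inv_mul _ (isUnit_iff_ne_zero.2 hd1)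
      have h7 : (V + 1)⁻¹ * V = 1 - (V + 1)⁻¹ :=
        eq_sub_iff_add_eq.2 (by rw [← mul_add_one]; exact h6)
      have h8 : V * (V + 1)⁻¹ = 1 - (V + 1)⁻¹ :=
        eq_sub_iff_add_eq.2 (by rw [← add_one_mul]; exact h3)
      rw [h7, h8]
    rw [ofDisc, e2, h5, ← mul_assoc, sub_mul, h2, ofDisc, one_mul, ← neg_mul, neg_sub]
  have e4 : N (V⁻¹ + 1) = (N V)⁻¹ * N (V + 1) := by
    rw [e1, N, Matrix.det_mul, Matrix.det_nonsing_inv, Ring.inverse_eq_inv', N, N]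
  have hN : N V ≠ 0 := hd
  have hN1 : N (V + 1) ≠ 0 := hd1
  rw [discForm, discForm, e3, e4]
  field_simp

/-- Boundary values, absolute convergence and the reproducing formula in terms of `extendFrom`. -/
theorem reproducing_of_boundary_values {T : Set HC} (hT : minkowski ⊆ closure T) {F Fb : HC → ℂ}
    (h : ∀ Z ∈ minkowski, Tendsto F (𝓝[T] Z) (𝓝 (Fb Z)))
    (hW : ∀ W ∈ T, Integrable (fun y => Fb (point y) / N (point y - W) ^ 2) ∧
      ∫ y, Fb (point y) / N (point y - W) ^ 2 = (2 * Real.pi ^ 3 : ℝ) * F W) :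
    (∀ Z ∈ minkowski, Tendsto F (𝓝[T] Z) (𝓝 (extendFrom T F Z))) ∧
    ∀ W ∈ T, IntegrableM (fun Z => extendFrom T F Z / N (Z - W) ^ 2) ∧
      F W = pairing (extendFrom T F) (fun Z => 1 / N (Z - W) ^ 2) ∧
      F W = I / (8 * (Real.pi : ℂ) ^ 3) *
        integralM (fun Z => extendFrom T F Z / N (Z - W) ^ 2) := by
  have he : ∀ Z ∈ minkowski, extendFrom T F Z = Fb Z := fun Z hZ =>
    extendFrom_eq (hT hZ) (h Z hZ)
  refine ⟨fun Z hZ => by rw [he Z hZ]; exact h Z hZ, fun W hWT => ?_⟩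
  obtain ⟨h1, h2⟩ := hW W hWT
  have h3 : F W = I / (8 * (Real.pi : ℂ) ^ 3) *
      integralM (fun Z => extendFrom T F Z / N (Z - W) ^ 2) := by
    simp only [integralM, he _ (point_mem_minkowski _)]
    -- The constants multiply to one: `i/(8π³) · 2π³ · (-4i) = 1`.
    rw [integral_mul_const, h2, dZ4_basis]
    have : (Real.pi : ℂ) ≠ 0 := by exact_mod_cast Real.pi_ne_zero
    push_cast
    field_simp
    linear_combination (8 : ℂ) * F W * I_sq
  refine ⟨?_, ?_, h3⟩
  · simp only [IntegrableM, he _ (point_mem_minkowski _)]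
    exact h1.mul_const _
  · rw [pairing]
    simp only [mul_one_div]
    exact h3

theorem reproducing_ZhPlus {F : HC → ℂ} (hF : F ∈ ZhPlus) :
    (∀ Z ∈ minkowski, Tendsto F (𝓝[tubePlus] Z) (𝓝 (extendFrom tubePlus F Z))) ∧
    ∀ W ∈ tubePlus, IntegrableM (fun Z => extendFrom tubePlus F Z / N (Z - W) ^ 2) ∧
      F W = pairing (extendFrom tubePlus F) (fun Z => 1 / N (Z - W) ^ 2) ∧
      F W = I / (8 * (Real.pi : ℂ) ^ 3) *
        integralM (fun Z => extendFrom tubePlus F Z / N (Z - W) ^ 2) := by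
  obtain ⟨hd, U, hU, hcU, G, hG, hGF⟩ := hF
  have hGc : ContinuousOn G U := fun Z hZ => (continuousAt_of_differentiableAt
    ((hG Z hZ).differentiableAt (hU.mem_nhds hZ))).continuousWithinAt
  have hc : Continuous fun V : HC => I • V := by fun_prop
  -- The scalar `-1/4` undoes the factor `-4` in `rho1_cayley_inv_eq`.
  obtain ⟨h1, h2⟩ := reproducing_formula (G := fun V => -(1 / 4) * G (I • V)) hd
    (hU.preimage hc)
    (fun V hV => hcU (unitarySet_subset_closure_discPlus (smul_mem_unitarySet (by simp) hV)))
    (continuousOn_const.mul (hGc.comp hc.continuousOn fun V hV => hV))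
    (fun V hV _ => by
      rw [hGF (I_smul_mem_discPlus hV), rho1_cayley_inv_eq]; ring)
  exact reproducing_of_boundary_values minkowski_subset_closure_tubePlus h1 h2

theorem reproducing_ZhMinus {F : HC → ℂ} (hF : F ∈ ZhMinus) :
    (∀ Z ∈ minkowski, Tendsto F (𝓝[tubeMinus] Z) (𝓝 (extendFrom tubeMinus F Z))) ∧
    ∀ W ∈ tubeMinus, IntegrableM (fun Z => extendFrom tubeMinus F Z / N (Z - W) ^ 2) ∧
      F W = pairing (extendFrom tubeMinus F) (fun Z => 1 / N (Z - W) ^ 2) ∧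
      F W = I / (8 * (Real.pi : ℂ) ^ 3) *
        integralM (fun Z => extendFrom tubeMinus F Z / N (Z - W) ^ 2) := by
  obtain ⟨hd, U, hU, hcU, G, hG, hGF, -⟩ := hF
  have hGc : ContinuousOn G U := fun Z hZ => (continuousAt_of_differentiableAt
    ((hG Z hZ).differentiableAt (hU.mem_nhds hZ))).continuousWithinAt
  have hm : tubeMinus = Neg.neg ⁻¹' tubePlus := Set.ext fun Z => mem_tubeMinus
  have hopen : IsOpen tubeMinus := by rw [hm]; exact isOpen_tubePlus.preimage continuous_neg
  have hneg : ∀ Z ∈ tubePlus, -Z ∈ tubeMinus := fun Z hZ => by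
    rw [mem_tubeMinus, neg_neg]; exact hZ
  have hd' : DifferentiableOn ℂ (fun Z => F (-Z)) tubePlus := fun Z hZ => by
    refine (differentiableAt_comp (f := fun Z => -Z) ((hd _ (hneg Z hZ)).differentiableAt
      (hopen.mem_nhds (hneg Z hZ))) ?_).differentiableWithinAt
    simpa using differentiableAt_const_smul (c := -1) (differentiableAt_id (x := Z))
  have hD : IsOpen {V : HC | V.det ≠ 0} := isOpen_ne_fun (by fun_prop) continuous_const
  have hc : ContinuousOn (fun V : HC => I • V⁻¹) {V : HC | V.det ≠ 0} :=
    continuousOn_matrix_inv.const_smul I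
  have hdet : ∀ V ∈ unitarySet, V.det ≠ 0 := fun V (hV : _ = _) h0 => by
    have := congrArg Matrix.det hV
    simp [h0] at this
  -- For `F(-Z)` the extension in disc coordinates is `-G(iV⁻¹) / (4 N(V)²)`. It is continuous where
  -- `V` is invertible and `iV⁻¹` lies in `U`; this set is open and contains `U(2)`.
  obtain ⟨h1, h2⟩ := reproducing_formula (G := fun V => -(1 / 4) * G (I • V⁻¹) / N V ^ 2) hd'
    (hc.isOpen_inter_preimage hD hU)
    (fun V hV => ⟨hdet V hV, hcU (unitarySet_subset_closure_discMinus
      (smul_mem_unitarySet (by simp) (by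
        have hV' : V * Vᴴ = 1 := hV
        change _ * _ = _
        rw [Matrix.inv_eq_right_inv hV', Matrix.conjTranspose_conjTranspose]
        exact mul_eq_one_comm.1 hV')))⟩)
    (ContinuousOn.div (continuousOn_const.mul (hGc.comp (hc.mono Set.inter_subset_left)
      fun V hV => hV.2)) (continuous_N.pow 2).continuousOn fun V hV => pow_ne_zero 2 hV.1)
    (fun V hV hV' => by
      rw [hGF (I_smul_inv_mem_discMinus hV hV'.1), rho1_cayley_inv_eq,
        discForm_comp_neg hV hV'.1]
      ring)
  set Fb : HC → ℂ := fun Z => 16 * (-(1 / 4) * G (I • (toDisc Z)⁻¹) / N (toDisc Z) ^ 2) /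
    N (1 - Z) ^ 2 with hFb
  have hpn : ∀ y, point (-y) = -point y := fun y => by simp [point]
  refine reproducing_of_boundary_values (Fb := fun Z => Fb (-Z))
    minkowski_subset_closure_tubeMinus (fun Z hZ => ?_) fun W hW => ?_
  · have h3 := (h1 _ (neg_mem_minkowski.2 hZ)).comp (f := Neg.neg) (x := 𝓝[tubeMinus] Z)
      (tendsto_nhdsWithin_iff.2 ⟨continuous_neg.continuousAt.tendsto.mono_left nhdsWithin_le_nhds,
        eventually_nhdsWithin_of_forall fun Z hZ => mem_tubeMinus.1 hZ⟩)
    simpa only [Function.comp_def, neg_neg] using h3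
  · obtain ⟨h4, h5⟩ := h2 _ (mem_tubeMinus.1 hW)
    have e : ∀ y, Fb (-point y) / N (point y - W) ^ 2 =
        (fun y => Fb (point y) / N (point y - -W) ^ 2) (-y) := fun y => by
      have : N (point (-y) - -W) = N (point y - W) := by
        have e' : point (-y) - -W = -(point y - W) := by rw [hpn]; abel
        rw [e', N, Matrix.det_neg, N]; simp
      change _ = Fb (point (-y)) / N (point (-y) - -W) ^ 2
      rw [this, hpn]
    simp only [e]
    refine ⟨h4.comp_neg, ?_⟩
    rw [integral_neg_eq_self (fun y => Fb (point y) / N (point y - -W) ^ 2), h5, neg_neg]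

end HC

/-- The values on Minkowski space of a function on a tube domain are its boundary values, that is
its limits from within the tube domain. -/
theorem mainTheorem11 :
    (∀ F ∈ HC.ZhPlus,
      (∀ Z ∈ HC.minkowski, Filter.Tendsto F (nhdsWithin Z HC.tubePlus)
        (nhds (extendFrom HC.tubePlus F Z))) ∧
      ∀ W ∈ HC.tubePlus,
        HC.IntegrableM (fun Z => extendFrom HC.tubePlus F Z / HC.N (Z - W) ^ 2) ∧
        F W = HC.pairing (extendFrom HC.tubePlus F) (fun Z => 1 / HC.N (Z - W) ^ 2) ∧
        F W = Complex.I / (8 * (Real.pi : ℂ) ^ 3) *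
          HC.integralM (fun Z => extendFrom HC.tubePlus F Z / HC.N (Z - W) ^ 2)) ∧
    (∀ F ∈ HC.ZhMinus,
      (∀ Z ∈ HC.minkowski, Filter.Tendsto F (nhdsWithin Z HC.tubeMinus)
        (nhds (extendFrom HC.tubeMinus F Z))) ∧
      ∀ W ∈ HC.tubeMinus,
        HC.IntegrableM (fun Z => extendFrom HC.tubeMinus F Z / HC.N (Z - W) ^ 2) ∧
        F W = HC.pairing (extendFrom HC.tubeMinus F) (fun Z => 1 / HC.N (Z - W) ^ 2) ∧
        F W = Complex.I / (8 * (Real.pi : ℂ) ^ 3) *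
          HC.integralM (fun Z => extendFrom HC.tubeMinus F Z / HC.N (Z - W) ^ 2)) :=
  ⟨fun _ hF => HC.reproducing_ZhPlus hF, fun _ hF => HC.reproducing_ZhMinus hF⟩
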